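/- Let $\mathbb{M}^2(\kappa)\subset\mathbb{R}^3_\kappa$ be the unit sphere $\mathbb{S}^2$ if $\kappa=1$ and the hyperbolic plane $\mathbb{H}^2$ (the upper sheet of the hyperboloid $x_1^2+x_2^2-x_3^2=-1$ in Lorentz–Minkowski space) if $\kappa=-1$, let $\mathbb{M}^2(\kappa)\times\mathbb{R}$ carry the product metric, and let $\partial_z$ be the unit vertical vector field. Given $\mathcal{H}\in C^1([-1,1])$, an $\mathcal{H}$-surface in $\mathbb{M}^2(\kappa)\times\mathbb{R}$ is an immersed surface of class $C^2$, oriented by a unit normal field $\eta$, whose mean curvature with respect to $\eta$ (half the trace of the shape operator $X\mapsto-\nabla_X\eta$) equals $\mathcal{H}(\langle\eta_p,\partial_z\rangle)$ at each of its points $p$. A surface is closed if it is non-empty, compact, connected and without boundary. Let $\mathcal{H}\in C^1([-1,1])$, and let $\mathcal{K}$ be a closed $\mathcal{H}$-surface in $\mathbb{M}^2(\kappa)\times\mathbb{R}$, $\kappa=\pm1$, immersed by $f:\mathcal{K}\to\mathbb{M}^2(\kappa)\times\mathbb{R}$. 1. If $\kappa=-1$ (so that $\mathcal{K}$ lies in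 $\mathbb{H}^2\times\mathbb{R}$), then $\mathcal{H}(-1)\mathcal{H}(1)>0$. 2. If $\kappa=1$ (so that $\mathcal{K}$ lies in $\mathbb{S}^2\times\mathbb{R}$), then either $\mathcal{H}(-1)\mathcal{H}(1)>0$, or $\mathcal{H}(-1)\mathcal{H}(1)=0$ and $\mathcal{K}$ is a horizontal slice: $f$ is injective and its image is $\mathbb{S}^2\times\{t_0\}$ for some $t_0\in\mathbb{R}$. -/

import Mathlib

open scoped Manifold ContDiff

noncomputable section

namespace ProductSurface

/-- The linear space `ℝ³ × ℝ`, in which both `𝕊² × ℝ` and `ℍ² × ℝ` are realized. It carries the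
metric `form κ` below; its norm is used only for its topology and differential calculus. -/
abbrev Ambient : Type := (Fin 3 → ℝ) × ℝ

/-- The flat metric of `ℝ³_κ × ℝ`, for `κ = 1` (Euclidean, signature `+,+,+,+`) or `κ = -1`
(Lorentzian, signature `+,+,-,+`). -/
def form (κ : ℝ) (v w : Ambient) : ℝ :=
  v.1 0 * w.1 0 + v.1 1 * w.1 1 + κ * (v.1 2 * w.1 2) + v.2 * w.2

/-- The surface `𝕄²(κ)` as a quadric of `ℝ³_κ`: for `κ = 1` the unit sphere `𝕊²`, for `κ = -1` the
upper sheet of the two-sheeted hyperboloid, that is the hyperbolic plane `ℍ²`. -/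
def base (κ : ℝ) : Set (Fin 3 → ℝ) :=
  {x | x 0 ^ 2 + x 1 ^ 2 + κ * x 2 ^ 2 = 1 / κ ∧ 0 ≤ (1 - κ) * x 2}

/-- The product space `𝕄²(κ) × ℝ`. It carries the (Riemannian) restriction of `form κ`. -/
def space (κ : ℝ) : Set Ambient := base κ ×ˢ Set.univ

/-- The vector field `(x, z) ↦ (x, 0)`, which along `𝕄²(κ) × ℝ` is normal to it for `form κ` and
has square norm `κ = ±1`. -/
def radial (p : Ambient) : Ambient := (p.1, 0)

/-- The vertical unit vector field `∂_z`. -/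
def vertical : Ambient := (0, 1)

/-- `v` is tangent to `𝕄²(κ) × ℝ` at its point `p`. -/
def IsTangent (κ : ℝ) (p v : Ambient) : Prop := form κ v (radial p) = 0

/-- The orthogonal projection of `ℝ³_κ × ℝ` onto the tangent space of `𝕄²(κ) × ℝ` at `p`. The
Levi-Civita connection of `𝕄²(κ) × ℝ` is the flat derivative followed by this projection. -/
def tangentProj (κ : ℝ) (p v : Ambient) : Ambient :=
  v - (κ * form κ v (radial p)) • radial p

variable {S : Type*} [TopologicalSpace S] [ChartedSpace (EuclideanSpace ℝ (Fin 2)) S]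

/-- The differential at `p` of a map from the surface `S` to `ℝ³ × ℝ`, on the vectors of the
standard basis of the tangent plane `T_p S` (which Mathlib models as `ℝ²`). -/
def partialD (f : S → Ambient) (p : S) (i : Fin 2) : Ambient :=
  mfderiv (𝓡 2) 𝓘(ℝ, Ambient) f p (EuclideanSpace.single i (1 : ℝ) : EuclideanSpace ℝ (Fin 2))

/-- `f` is a `C²` immersion of the surface `S` into `𝕄²(κ) × ℝ`. -/
structure IsImmersedSurface (κ : ℝ) (f : S → Ambient) : Prop where
  mem : ∀ p, f p ∈ space κ
  contMDiff : ContMDiff (𝓡 2) 𝓘(ℝ, Ambient) 2 f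
  immersion : ∀ p, Function.Injective (mfderiv (𝓡 2) 𝓘(ℝ, Ambient) f p)

/-- `η` is a unit normal vector field, of class `C¹`, of the surface `f` in `𝕄²(κ) × ℝ`. -/
structure IsUnitNormal (κ : ℝ) (f η : S → Ambient) : Prop where
  contMDiff : ContMDiff (𝓡 2) 𝓘(ℝ, Ambient) 1 η
  tangent : ∀ p, IsTangent κ (f p) (η p)
  normal : ∀ p (v : TangentSpace (𝓡 2) p),
    form κ (η p) (mfderiv (𝓡 2) 𝓘(ℝ, Ambient) f p v : Ambient) = 0
  unit : ∀ p, form κ (η p) (η p) = 1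

/-- The matrix `⟨df e_i, df e_j⟩` of the first fundamental form. -/
def firstForm (κ : ℝ) (f : S → Ambient) (p : S) : Matrix (Fin 2) (Fin 2) ℝ :=
  Matrix.of fun i j => form κ (partialD f p i) (partialD f p j)

/-- The matrix `-⟨∇_{e_i} η, df e_j⟩` of the second fundamental form with respect to `η`, where `∇`
is the Levi-Civita connection of `𝕄²(κ) × ℝ`. -/
def secondForm (κ : ℝ) (f η : S → Ambient) (p : S) : Matrix (Fin 2) (Fin 2) ℝ :=
  Matrix.of fun i j => - form κ (tangentProj κ (f p) (partialD η p i)) (partialD f p j)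

/-- The mean curvature with respect to `η`: half the trace of the shape operator, that is half the
trace of the second fundamental form with respect to the first one. -/
def meanCurvature (κ : ℝ) (f η : S → Ambient) (p : S) : ℝ :=
  ((firstForm κ f p)⁻¹ * secondForm κ f η p).trace / 2

/-- The angle function `ν = ⟨η, ∂_z⟩`. -/
def angle (κ : ℝ) (η : S → Ambient) (p : S) : ℝ := form κ (η p) vertical

/-- The surface `f`, oriented by `η`, is an immersed surface in `𝕄²(κ) × ℝ` of prescribed mean
curvature `H` (an `H`-surface). -/
structure IsHSurface (κ : ℝ) (H : ℝ → ℝ) (f η : S → Ambient) : Prop where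
  immersed : IsImmersedSurface κ f
  unitNormal : IsUnitNormal κ f η
  meanCurvature_eq : ∀ p, meanCurvature κ f η p = H (angle κ η p)

end ProductSurface

end

/-!
Let `z` be the height and `ν = ⟨η, ∂_z⟩` the angle function of a closed `H`-surface. In a frame
`ζ 0, ζ 1` that is orthonormal for the induced metric the height satisfies

  `∑ D²z(ζ k, ζ k) = ∑ c k * Dz(ζ k) + 2 H(ν) ν`,   `|∇z|² = 1 - ν²`

with locally bounded `c k` (`IsHPatch.sum_fderiv_fderiv_snd`, `IsHPatch.sq_add_sq_add_sq`): expand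
the second derivative of the immersion in the frame formed by the tangent plane, the normal `η` and
the position vector of `𝕄²(κ)`, which has no vertical component. At the highest point `ν = ±1` and
`H(ν) ν ≤ 0`, at the lowest point `ν = ±1` and `H(ν) ν ≥ 0`. If `H(ν)` is nonzero at both points,
then the two values of `ν` are opposite and `H(-1)`, `H(1)` have the same sign.

Otherwise `H(ε) = 0` for the angle `ε = ±1` at one of these points. As `H` is Lipschitz and
`|ν - ε| ≤ 1 - ν² = |∇z|²` wherever `ν` and `ε` have the same sign, the height satisfies near that
point a linear elliptic inequality `|∑ D²z(ζ k, ζ k)| ≤ C ∑ |Dz(ζ k)|`. Hopf's strong maximum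
principle (`eventually_eq_of_isMaxOn_of_elliptic`) makes `z` locally constant there, and by
connectedness the surface is horizontal (`IsHSurface.height_eq`).

A closed horizontal surface does not exist in `ℍ² × ℝ`: the first coordinate of `ℝ³` would attain
its maximum on it, whereas that coordinate has no critical point. In `𝕊² × ℝ` the projection of a
closed horizontal surface to `𝕊²` is a local homeomorphism, hence a covering, hence bijective
because the sphere is simply connected. The last step is carried out by hand in `IsLocalHomeomorph.injective_of_sphere`,
which glues sections over two punctured spheres.
-/

open scoped Manifold ContDiff Topology
open Set Filter Metric

/-! ### Hopf’s strong maximum principle -/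

section StrongMaximum

variable {V : Type*} [NormedAddCommGroup V] [InnerProductSpace ℝ V]

theorem hasDerivAt_comp_line {f : V → ℝ} {x ξ : V} {t : ℝ} (hf : DifferentiableAt ℝ f (x + t • ξ)) :
    HasDerivAt (fun s : ℝ => f (x + s • ξ)) (fderiv ℝ f (x + t • ξ) ξ) t := by
  have h1 : HasDerivAt (fun s : ℝ => x + s • ξ) ξ t := by
    simpa using ((hasDerivAt_id t).smul_const ξ).const_add x
  exact hf.hasFDerivAt.comp_hasDerivAt t h1

/-- The Hessian of a `C²` function is negative semidefinite at a local maximum. -/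
theorem IsLocalMax.fderiv_fderiv_nonpos {f : V → ℝ} {x : V} (hf : ContDiffAt ℝ 2 f x)
    (h : IsLocalMax f x) (ξ : V) : fderiv ℝ (fderiv ℝ f) x ξ ξ ≤ 0 := by
  by_contra! hpos
  set g : ℝ → ℝ := fun s => f (x + s • ξ) with hg
  have hline : Tendsto (fun s : ℝ => x + s • ξ) (𝓝 0) (𝓝 x) := by
    have : Continuous (fun s : ℝ => x + s • ξ) := by fun_prop
    simpa using this.tendsto 0
  have hd : ∀ᶠ s in 𝓝 (0 : ℝ), deriv g s = fderiv ℝ f (x + s • ξ) ξ := by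
    have h1 : ∀ᶠ y in 𝓝 x, ContDiffAt ℝ 2 f y := hf.eventually (by simp)
    filter_upwards [hline.eventually h1] with s hs
    exact (hasDerivAt_comp_line (hs.differentiableAt (by simp))).deriv
  have hd2 : HasDerivAt (fun s : ℝ => fderiv ℝ f (x + s • ξ) ξ)
      (fderiv ℝ (fderiv ℝ f) x ξ ξ) 0 := by
    have h1 : DifferentiableAt ℝ (fderiv ℝ f) x :=
      (hf.fderiv_right (m := 1) (by norm_num)).differentiableAt (by simp)
    have h2 : HasDerivAt (fun s : ℝ => x + s • ξ) ξ 0 := by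
      simpa using ((hasDerivAt_id (0 : ℝ)).smul_const ξ).const_add x
    have h3 : HasFDerivAt (fderiv ℝ f) (fderiv ℝ (fderiv ℝ f) x) (x + (0 : ℝ) • ξ) := by
      simpa using h1.hasFDerivAt
    exact (ContinuousLinearMap.apply ℝ ℝ ξ).hasFDerivAt.comp_hasDerivAt (0 : ℝ)
      (h3.comp_hasDerivAt (0 : ℝ) h2)
  have hdd : deriv (deriv g) 0 = fderiv ℝ (fderiv ℝ f) x ξ ξ :=
    (hd2.congr_of_eventuallyEq hd).deriv
  have hmax : IsLocalMax g 0 := by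
    have := hline.eventually h
    simpa [IsLocalMax, IsMaxFilter, hg] using this
  have hc : ContinuousAt g 0 := by
    have : ContinuousAt f (x + (0 : ℝ) • ξ) := by simpa using hf.continuousAt
    exact ContinuousAt.comp (f := fun s : ℝ => x + s • ξ) this (by fun_prop)
  have hmin : IsLocalMin g 0 :=
    isLocalMin_of_deriv_deriv_pos (by rw [hdd]; exact hpos) hmax.deriv_eq_zero hc
  have hconst : g =ᶠ[𝓝 0] fun _ => g 0 := by
    filter_upwards [hmax, hmin] with s h1 h2 using le_antisymm h1 h2
  have hz : deriv (deriv g) 0 = 0 := by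
    rw [hconst.deriv.deriv_eq]; simp
  linarith

theorem hasFDerivAt_gaussian (α : ℝ) (y x : V) :
    HasFDerivAt (fun x => Real.exp (-α * ‖x - y‖ ^ 2))
      ((-2 * α * Real.exp (-α * ‖x - y‖ ^ 2)) • innerSL ℝ (x - y)) x := by
  have h1 : HasFDerivAt (fun x : V => ‖x - y‖ ^ 2) (2 • innerSL ℝ (x - y)) x :=
    ((hasFDerivAt_id x).sub_const y).norm_sq
  convert! (h1.const_mul (-α)).exp using 1
  ext ξ
  simp
  ring

theorem fderiv_fderiv_gaussian (α : ℝ) (y x ξ : V) :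
    fderiv ℝ (fderiv ℝ fun x => Real.exp (-α * ‖x - y‖ ^ 2)) x ξ ξ =
      (4 * α ^ 2 * inner ℝ (x - y) ξ ^ 2 - 2 * α * ‖ξ‖ ^ 2) * Real.exp (-α * ‖x - y‖ ^ 2) := by
  have h0 : (fderiv ℝ fun x => Real.exp (-α * ‖x - y‖ ^ 2)) =
      fun x => (-2 * α * Real.exp (-α * ‖x - y‖ ^ 2)) • innerSL ℝ (x - y) :=
    funext fun x => (hasFDerivAt_gaussian α y x).fderiv
  have h1 : HasFDerivAt (fun x : V => innerSL ℝ (x - y)) (innerSL ℝ (E := V)) x :=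
    (innerSL ℝ (E := V)).hasFDerivAt.comp x ((hasFDerivAt_id x).sub_const y)
  have h2 := ((hasFDerivAt_gaussian α y x).const_mul (-2 * α)).smul h1
  rw [h0]
  change fderiv ℝ ((fun x => -2 * α * Real.exp (-α * ‖x - y‖ ^ 2)) • fun x => innerSL ℝ (x - y))
    x ξ ξ = _
  rw [h2.fderiv]
  have h3 : innerSL ℝ ξ ξ = ‖ξ‖ ^ 2 := by
    rw [innerSL_apply_apply, real_inner_self_eq_norm_sq]
  simp only [add_apply, smul_apply, smul_eq_mul, ContinuousLinearMap.smulRight_apply, h3,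
    innerSL_apply_apply]
  ring

/-- The contradictory inequality satisfied at an interior maximum by the barrier. -/
theorem barrier_inequality {δ α g C c R i₀ i₁ n₀ n₁ : ℝ} (hδ : 0 < δ) (hα : 0 < α) (hg : 0 < g)
    (hC : 0 ≤ C) (hi₀ : |i₀| ≤ 3 / 2 * R * C) (hi₁ : |i₁| ≤ 3 / 2 * R * C)
    (hn₀ : n₀ ≤ C ^ 2) (hn₁ : n₁ ≤ C ^ 2) (hell : c * (R ^ 2 / 4) ≤ i₀ ^ 2 + i₁ ^ 2)
    (hαe : α * (c * R ^ 2) = 2 * (3 * R * C ^ 2 + 2 * C ^ 2 + 1))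
    (h : -(C * (δ * α * g * |i₀| + δ * α * g * |i₁|)) ≤
      -(δ / 2 * ((4 * α ^ 2 * i₀ ^ 2 - 2 * α * n₀) * g)) +
      -(δ / 2 * ((4 * α ^ 2 * i₁ ^ 2 - 2 * α * n₁) * g))) : False := by
  have key : 0 ≤ δ * α * g * (C * (|i₀| + |i₁|) + (n₀ + n₁) - 2 * α * (i₀ ^ 2 + i₁ ^ 2)) := by
    linarith
  have key2 : 0 ≤ C * (|i₀| + |i₁|) + (n₀ + n₁) - 2 * α * (i₀ ^ 2 + i₁ ^ 2) :=
    nonneg_of_mul_nonneg_right key (by positivity)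
  have h1 : α * (c * (R ^ 2 / 4)) ≤ α * (i₀ ^ 2 + i₁ ^ 2) := by gcongr
  have h2 : C * (|i₀| + |i₁|) ≤ C * (3 * R * C) := by gcongr; linarith
  linarith

/-- **Hopf's strong maximum principle**, local form. The trace of the Hessian in the moving frame
`ξ 0, ξ 1` is a second order operator; bounded frames and the lower bound `c ‖w‖²` make it uniformly
elliptic, and the function is a subsolution up to a multiple of its gradient. No regularity of the
frame is needed. -/
theorem eventually_eq_of_isMaxOn_of_elliptic [ProperSpace V] {u : V → ℝ} {U : Set V}
    (hU : IsOpen U) (hu : ContDiffOn ℝ 2 u U) {C c : ℝ} (hC : 0 ≤ C) (hc : 0 < c)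
    (ell : ∀ x ∈ U, ∃ ξ : Fin 2 → V, (∀ k, ‖ξ k‖ ≤ C) ∧
      (∀ w, c * ‖w‖ ^ 2 ≤ ∑ k, inner ℝ w (ξ k) ^ 2) ∧
      -(C * ∑ k, |fderiv ℝ u x (ξ k)|) ≤ ∑ k, fderiv ℝ (fderiv ℝ u) x (ξ k) (ξ k))
    {x₀ : V} (hx₀ : x₀ ∈ U) (hmax : ∀ x ∈ U, u x ≤ u x₀) : ∀ᶠ x in 𝓝 x₀, u x = u x₀ := by
  obtain ⟨r, hr, hrU⟩ := Metric.isOpen_iff.1 hU x₀ hx₀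
  have hr2 : closedBall x₀ (r / 2) ⊆ U := (closedBall_subset_ball (by linarith)).trans hrU
  by_contra hne
  obtain ⟨y, hy, hyr⟩ : ∃ y, ¬ u y = u x₀ ∧ dist y x₀ < r / 8 := by
    have := (Filter.not_eventually.1 hne).and_eventually
      (Metric.ball_mem_nhds x₀ (by linarith : 0 < r / 8))
    obtain ⟨y, h1, h2⟩ := this.exists
    exact ⟨y, h1, h2⟩
  have hcont : ContinuousOn u U := hu.continuousOn
  -- A point `x₁` of the contact set `{u = u x₀}` nearest to `y`.
  set K := closedBall x₀ (r / 2) ∩ {x | u x = u x₀} with hK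
  have hKc : IsCompact K := by
    refine (isCompact_closedBall x₀ (r / 2)).of_isClosed_subset ?_ inter_subset_left
    exact (hcont.mono hr2).preimage_isClosed_of_isClosed isClosed_closedBall isClosed_singleton
  have hx₀K : x₀ ∈ K := ⟨mem_closedBall_self (by linarith), rfl⟩
  obtain ⟨x₁, hx₁K, hx₁⟩ := hKc.exists_infDist_eq_dist ⟨x₀, hx₀K⟩ y
  have hnear : ∀ x ∈ K, dist y x₁ ≤ dist y x := fun x hx => hx₁ ▸ infDist_le_dist_of_mem hx
  have hR0 : dist y x₁ < r / 8 := (hnear x₀ hx₀K).trans_lt hyr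
  have hR0pos : 0 < dist y x₁ := dist_pos.2 fun h => hy (h ▸ hx₁K.2)
  set R := dist y x₁ / 2 with hR
  have hRpos : 0 < R := by positivity
  -- The ball of radius `R` around the midpoint touches the contact set in `x₁` only.
  set z := midpoint ℝ y x₁ with hz
  have hzx₁ : ‖x₁ - z‖ = R := by
    rw [← dist_eq_norm, hz, dist_comm, dist_midpoint_right, hR, dist_comm]
    simp; ring
  have hyz : y = z - (x₁ - z) := by
    have : z + z = y + x₁ := by rw [hz]; exact midpoint_add_self ℝ y x₁
    have h2 : y = z + z - x₁ := by rw [this]; abel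
    rw [h2]; abel
  have hin : ∀ x, ‖x - z‖ ≤ R → x ≠ x₁ → u x < u x₀ := by
    intro x hx hxx
    have h1 : dist x y < dist y x₁ := by
      have h2 : ‖(x - z) + (x₁ - z)‖ ^ 2 + ‖(x - z) - (x₁ - z)‖ ^ 2
          = 2 * (‖x - z‖ ^ 2 + ‖x₁ - z‖ ^ 2) := by
        have := parallelogram_law_with_norm ℝ (x - z) (x₁ - z)
        nlinarith [this]
      have h3 : 0 < ‖(x - z) - (x₁ - z)‖ := by
        rw [norm_pos_iff]; simpa [sub_eq_zero] using hxx
      have h4 : dist x y = ‖(x - z) + (x₁ - z)‖ := by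
        rw [dist_eq_norm]; congr 1; nth_rewrite 1 [hyz]; abel
      have h5 : dist y x₁ = 2 * R := by rw [hR]; ring
      rw [h4, h5, hzx₁] at *
      refine lt_of_pow_lt_pow_left₀ 2 (by positivity) ?_
      nlinarith [norm_nonneg (x - z)]
    have h2 : x ∈ closedBall x₀ (r / 2) := by
      have := dist_triangle x y x₀
      rw [mem_closedBall]; linarith
    refine lt_of_le_of_ne (hmax x (hr2 h2)) fun h => ?_
    have := hnear x ⟨h2, h⟩
    rw [dist_comm y x] at this
    linarith
  have hB : closedBall x₁ (R / 2) ⊆ closedBall x₀ (r / 2) := by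
    intro x hx
    have h1 := dist_triangle x x₁ x₀
    have h2 := dist_triangle x₁ y x₀
    rw [mem_closedBall] at hx ⊢
    rw [dist_comm x₁ y] at h2
    linarith
  -- The barrier is a Gaussian centred at `z`; for this large `α` it is a strict subsolution on
  -- `closedBall x₁ (R / 2)`, which stays away from `z`.
  set α := 2 * (3 * R * C ^ 2 + 2 * C ^ 2 + 1) / (c * R ^ 2) with hα
  have hαpos : 0 < α := by positivity
  set G : V → ℝ := fun x => Real.exp (-α * ‖x - z‖ ^ 2) with hG
  obtain ⟨δ, hδ, hδu⟩ : ∃ δ > 0, ∀ x ∈ sphere x₁ (R / 2) ∩ closedBall z R, u x ≤ u x₀ - δ := by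
    have hcp : IsCompact (sphere x₁ (R / 2) ∩ closedBall z R) :=
      (isCompact_sphere _ _).inter_right isClosed_closedBall
    rcases (sphere x₁ (R / 2) ∩ closedBall z R).eq_empty_or_nonempty with he | hne
    · exact ⟨1, one_pos, by simp [he]⟩
    · obtain ⟨w, hw, hwm⟩ := hcp.exists_isMaxOn hne
        (hcont.mono ((inter_subset_left.trans sphere_subset_closedBall).trans (hB.trans hr2)))
      refine ⟨u x₀ - u w, ?_, fun x hx => by
        have := hwm hx
        simp only [mem_ofPred_eq] at this
        linarith⟩
      have h1 : w ≠ x₁ := by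
        rintro rfl
        have := hw.1
        rw [mem_sphere, dist_self] at this
        linarith
      have := hin w (by rw [← dist_eq_norm]; exact hw.2) h1
      linarith
  -- A perturbation of `u` so small that its maximum over `closedBall x₁ (R / 2)` is not attained
  -- on the boundary.
  set v : V → ℝ := fun x => u x + δ / 2 * G x with hv
  have hGR : ∀ x, R < ‖x - z‖ → G x < Real.exp (-α * R ^ 2) := by
    intro x hx
    have : R ^ 2 < ‖x - z‖ ^ 2 := by gcongr
    exact Real.exp_lt_exp.2 (by nlinarith)
  have hG1 : ∀ x, G x ≤ 1 := fun x => Real.exp_le_one_iff.2 (by nlinarith [sq_nonneg ‖x - z‖])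
  have hGcont : Continuous G := by fun_prop
  have hvc : ContinuousOn v (closedBall x₁ (R / 2)) :=
    (hcont.mono (hB.trans hr2)).add (by fun_prop)
  obtain ⟨x₂, hx₂, hx₂max⟩ := (isCompact_closedBall x₁ (R / 2)).exists_isMaxOn
    ⟨x₁, mem_closedBall_self (by positivity)⟩ hvc
  have hvx₁ : v x₁ = u x₀ + δ / 2 * Real.exp (-α * R ^ 2) := by
    simp only [hv, hG, hzx₁]; rw [hx₁K.2]
  have hvx₂ : u x₀ + δ / 2 * Real.exp (-α * R ^ 2) ≤ v x₂ :=
    hvx₁ ▸ hx₂max (mem_closedBall_self (by positivity))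
  have hx₂b : x₂ ∈ ball x₁ (R / 2) := by
    rcases (mem_closedBall.1 hx₂).lt_or_eq with h | h
    · exact h
    exfalso
    by_cases hzx : ‖x₂ - z‖ ≤ R
    · have h1 := hδu x₂ ⟨h, by rw [mem_closedBall, dist_eq_norm]; exact hzx⟩
      have h2 := hG1 x₂
      have h3 : 0 < Real.exp (-α * R ^ 2) := Real.exp_pos _
      simp only [hv] at hvx₂
      nlinarith
    · have h1 := hmax x₂ (hr2 (hB hx₂))
      have h2 := hGR x₂ (not_le.1 hzx)
      simp only [hv] at hvx₂
      nlinarith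
  have hx₂U : x₂ ∈ U := hr2 (hB hx₂)
  have hloc : IsLocalMax v x₂ :=
    Filter.mem_of_superset (isOpen_ball.mem_nhds hx₂b) fun x hx =>
      hx₂max (ball_subset_closedBall hx)
  have huat : ∀ᶠ x in 𝓝 x₂, ContDiffAt ℝ 2 u x :=
    Filter.mem_of_superset (hU.mem_nhds hx₂U) fun x hx => hu.contDiffAt (hU.mem_nhds hx)
  have hGd : ContDiff ℝ 2 G := by
    have : ContDiff ℝ 2 (fun x : V => ‖x - z‖ ^ 2) := (contDiff_id.sub contDiff_const).norm_sq ℝ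
    exact (contDiff_const.mul this).exp
  have hfd : ∀ x, ContDiffAt ℝ 2 u x → fderiv ℝ v x = fderiv ℝ u x + (δ / 2) • fderiv ℝ G x := by
    intro x hx
    have hGx : DifferentiableAt ℝ G x := hGd.differentiable (by simp) x
    rw [hv, fderiv_fun_add (hx.differentiableAt (by simp)) (hGx.const_mul _),
      fderiv_const_mul hGx]
  have hfd2 : fderiv ℝ (fderiv ℝ v) x₂ =
      fderiv ℝ (fderiv ℝ u) x₂ + (δ / 2) • fderiv ℝ (fderiv ℝ G) x₂ := by
    have h1 : fderiv ℝ v =ᶠ[𝓝 x₂] fun x => fderiv ℝ u x + (δ / 2) • fderiv ℝ G x :=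
      huat.mono hfd
    have h2 : DifferentiableAt ℝ (fderiv ℝ u) x₂ :=
      (huat.self_of_nhds.fderiv_right (m := 1) (by norm_num)).differentiableAt (by simp)
    have h3 : DifferentiableAt ℝ (fderiv ℝ G) x₂ :=
      (hGd.fderiv_right (m := 1) (by norm_num)).differentiable (by simp) x₂
    rw [h1.fderiv_eq]
    exact (h2.hasFDerivAt.add (h3.hasFDerivAt.const_smul (δ / 2))).fderiv
  have hcrit := hfd x₂ huat.self_of_nhds
  rw [hloc.fderiv_eq_zero] at hcrit
  have hvC2 : ContDiffAt ℝ 2 v x₂ := huat.self_of_nhds.add (contDiffAt_const.mul hGd.contDiffAt)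
  obtain ⟨ξ, hξC, hξc, hξu⟩ := ell x₂ hx₂U
  set g := G x₂ with hg
  have hgpos : 0 < g := Real.exp_pos _
  have hDu : ∀ k, fderiv ℝ u x₂ (ξ k) = δ * α * g * inner ℝ (x₂ - z) (ξ k) := by
    intro k
    have := congrArg (fun L : V →L[ℝ] ℝ => L (ξ k)) hcrit
    simp only [hG, (hasFDerivAt_gaussian α z x₂).fderiv] at this
    simp only [zero_apply, add_apply, smul_apply, smul_eq_mul, innerSL_apply_apply] at this
    simp only [hg, hG]
    linarith
  have hH : ∀ k, fderiv ℝ (fderiv ℝ u) x₂ (ξ k) (ξ k) ≤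
      -(δ / 2 * ((4 * α ^ 2 * inner ℝ (x₂ - z) (ξ k) ^ 2 - 2 * α * ‖ξ k‖ ^ 2) * g)) := by
    intro k
    have h1 := hloc.fderiv_fderiv_nonpos hvC2 (ξ k)
    have h2 := fderiv_fderiv_gaussian α z x₂ (ξ k)
    rw [hfd2] at h1
    simp only [add_apply, smul_apply, smul_eq_mul] at h1
    rw [h2] at h1
    simp only [hg, hG]
    linarith
  have hd1 : ‖x₂ - z‖ ≤ 3 / 2 * R := by
    have h1 : ‖x₂ - z‖ ≤ ‖x₂ - x₁‖ + ‖x₁ - z‖ := by simpa using norm_add_le (x₂ - x₁) (x₁ - z)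
    rw [mem_ball, dist_eq_norm] at hx₂b
    linarith
  have hd2 : R / 2 ≤ ‖x₂ - z‖ := by
    have h1 : ‖x₁ - z‖ ≤ ‖x₁ - x₂‖ + ‖x₂ - z‖ := by simpa using norm_add_le (x₁ - x₂) (x₂ - z)
    rw [mem_ball, dist_comm, dist_eq_norm] at hx₂b
    linarith
  have hin2 : ∀ k, |inner ℝ (x₂ - z) (ξ k)| ≤ 3 / 2 * R * C := fun k =>
    (abs_real_inner_le_norm _ _).trans (by gcongr; exact hξC k)
  have hξ2 : ∀ k, ‖ξ k‖ ^ 2 ≤ C ^ 2 := fun k => by gcongr; exact hξC k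
  have hell := hξc (x₂ - z)
  have hd3 : R ^ 2 / 4 ≤ ‖x₂ - z‖ ^ 2 := by nlinarith
  have hαe : α * (c * R ^ 2) = 2 * (3 * R * C ^ 2 + 2 * C ^ 2 + 1) := by
    rw [hα]; field_simp
  simp only [Fin.sum_univ_two, hDu, abs_mul, abs_of_pos hδ, abs_of_pos hαpos, abs_of_pos hgpos]
    at hξu hell
  refine barrier_inequality hδ hαpos hgpos hC (hin2 0) (hin2 1) (hξ2 0) (hξ2 1) ?_ hαe
    (hξu.trans (add_le_add (hH 0) (hH 1)))
  exact (by gcongr : c * (R ^ 2 / 4) ≤ c * ‖x₂ - z‖ ^ 2).trans hell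

end StrongMaximum

/-! ### The metric of the ambient space -/

namespace ProductSurface

/-- `form κ` as a bilinear map. -/
noncomputable def formBilin (κ : ℝ) : Ambient →ₗ[ℝ] Ambient →ₗ[ℝ] ℝ :=
  LinearMap.mk₂ ℝ (form κ) (by intros; simp [form]; ring) (by intros; simp [form]; ring)
    (by intros; simp [form]; ring) (by intros; simp [form]; ring)

@[simp] theorem formBilin_apply (κ : ℝ) (v w : Ambient) : formBilin κ v w = form κ v w := rfl

theorem form_comm (κ : ℝ) (v w : Ambient) : form κ v w = form κ w v := by
  simp only [form]; ring

theorem form_smul_left (κ a : ℝ) (v w : Ambient) : form κ (a • v) w = a * form κ v w := by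
  simp [form]; ring

theorem form_sub_left (κ : ℝ) (u v w : Ambient) : form κ (u - v) w = form κ u w - form κ v w := by
  simp [form]; ring

theorem form_sum_left {ι : Type*} (κ : ℝ) (s : Finset ι) (v : ι → Ambient) (w : Ambient) :
    form κ (∑ i ∈ s, v i) w = ∑ i ∈ s, form κ (v i) w := by
  simp only [← formBilin_apply, map_sum, LinearMap.sum_apply]

@[simp] theorem form_vertical (κ : ℝ) (v : Ambient) : form κ v vertical = v.2 := by
  simp [form, vertical]

theorem form_radial_radial (κ : ℝ) (v p : Ambient) :
    form κ (radial v) (radial p) = form κ v (radial p) := by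
  simp [form, radial]

theorem abs_form_le {κ : ℝ} (hκ : |κ| = 1) (v w : Ambient) : |form κ v w| ≤ 4 * (‖v‖ * ‖w‖) := by
  have h : ∀ i, |v.1 i * w.1 i| ≤ ‖v‖ * ‖w‖ := fun i => by
    rw [abs_mul]
    gcongr
    · exact (norm_le_pi_norm v.1 i).trans (norm_fst_le v)
    · exact (norm_le_pi_norm w.1 i).trans (norm_fst_le w)
  have h2 : |v.2 * w.2| ≤ ‖v‖ * ‖w‖ := by
    rw [abs_mul]
    gcongr
    · exact norm_snd_le v
    · exact norm_snd_le w
  have h3 : |κ * (v.1 2 * w.1 2)| ≤ ‖v‖ * ‖w‖ := by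
    rw [abs_mul, hκ, one_mul]; exact h 2
  rw [form]
  linarith [abs_add_le (v.1 0 * w.1 0 + v.1 1 * w.1 1 + κ * (v.1 2 * w.1 2)) (v.2 * w.2),
    abs_add_le (v.1 0 * w.1 0 + v.1 1 * w.1 1) (κ * (v.1 2 * w.1 2)),
    abs_add_le (v.1 0 * w.1 0) (v.1 1 * w.1 1), h 0, h 1]

theorem continuous_form (κ : ℝ) : Continuous fun p : Ambient × Ambient => form κ p.1 p.2 := by
  unfold form; fun_prop

section Calculus

variable {V : Type*} [NormedAddCommGroup V] [NormedSpace ℝ V]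

theorem fderiv_form {κ : ℝ} {f g : V → Ambient} {x : V} (hf : DifferentiableAt ℝ f x)
    (hg : DifferentiableAt ℝ g x) (v : V) :
    fderiv ℝ (fun y => form κ (f y) (g y)) x v =
      form κ (fderiv ℝ f x v) (g x) + form κ (f x) (fderiv ℝ g x v) := by
  have hp : ∀ {h : V → Ambient}, DifferentiableAt ℝ h x → ∀ i,
      HasFDerivAt (fun y => (h y).1 i)
        ((ContinuousLinearMap.proj i).comp
          ((ContinuousLinearMap.fst ℝ (Fin 3 → ℝ) ℝ).comp (fderiv ℝ h x))) x :=
    fun hh i => ((ContinuousLinearMap.proj (R := ℝ) (φ := fun _ : Fin 3 => ℝ) i).comp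
      (ContinuousLinearMap.fst ℝ (Fin 3 → ℝ) ℝ)).hasFDerivAt.comp x hh.hasFDerivAt
  have hs : ∀ {h : V → Ambient}, DifferentiableAt ℝ h x →
      HasFDerivAt (fun y => (h y).2)
        ((ContinuousLinearMap.snd ℝ (Fin 3 → ℝ) ℝ).comp (fderiv ℝ h x)) x :=
    fun hh => (ContinuousLinearMap.snd ℝ (Fin 3 → ℝ) ℝ).hasFDerivAt.comp x hh.hasFDerivAt
  have := ((((hp hf 0).mul (hp hg 0)).add ((hp hf 1).mul (hp hg 1))).add
    (((hp hf 2).mul (hp hg 2)).const_mul κ)).add ((hs hf).mul (hs hg))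
  have h2 : HasFDerivAt (fun y => form κ (f y) (g y)) _ x := this
  rw [h2.fderiv]
  simp [form]
  ring

end Calculus

theorem one_div_eq_self {κ : ℝ} (hκ : κ = 1 ∨ κ = -1) : 1 / κ = κ := by
  rcases hκ with rfl | rfl <;> norm_num

theorem form_radial_self {κ : ℝ} (hκ : κ = 1 ∨ κ = -1) {p : Ambient} (hp : p ∈ space κ) :
    form κ (radial p) (radial p) = κ := by
  have := hp.1.1
  rw [one_div_eq_self hκ] at this
  simp [form, radial]
  linarith

/-- The metric of `𝕄²(κ) × ℝ` is Riemannian. For `κ = -1` this is the reversed Cauchy–Schwarz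
inequality: vectors orthogonal to a timelike vector are spacelike. -/
theorem form_self_pos {κ : ℝ} (hκ : κ = 1 ∨ κ = -1) {p v : Ambient} (hp : p ∈ space κ)
    (hv : form κ v (radial p) = 0) (hv0 : v ≠ 0) : 0 < form κ v v := by
  have hne : v.1 0 ≠ 0 ∨ v.1 1 ≠ 0 ∨ v.1 2 ≠ 0 ∨ v.2 ≠ 0 := by
    by_contra! h
    apply hv0
    ext i
    · fin_cases i <;> simp [h]
    · simp [h]
  have hb := hp.1.1
  rcases hκ with rfl | rfl
  · simp only [form]
    rcases hne with h | h | h | h <;> have := pow_pos (abs_pos.2 h) 2 <;> rw [sq_abs] at this <;>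
      nlinarith [sq_nonneg (v.1 0), sq_nonneg (v.1 1), sq_nonneg (v.1 2), sq_nonneg v.2]
  · simp only [form, radial] at *
    set a := v.1 0
    set b := v.1 1
    set c := v.1 2
    set x := p.1 0
    set y := p.1 1
    set t := p.1 2
    have ht : t ^ 2 = 1 + x ^ 2 + y ^ 2 := by linarith
    have hct : c * t = a * x + b * y := by linarith
    -- `t² (a² + b² - c²) = a² + b² + (a y - b x)²`
    have hid : t ^ 2 * (a ^ 2 + b ^ 2 - c ^ 2) = a ^ 2 + b ^ 2 + (a * y - b * x) ^ 2 := by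
      have : t ^ 2 * c ^ 2 = (a * x + b * y) ^ 2 := by rw [← hct]; ring
      rw [mul_sub, this, ht]; ring
    have ht0 : 0 < t ^ 2 := by rw [ht]; positivity
    have hnn : 0 ≤ a ^ 2 + b ^ 2 - c ^ 2 := by
      have : 0 ≤ t ^ 2 * (a ^ 2 + b ^ 2 - c ^ 2) := by rw [hid]; positivity
      exact nonneg_of_mul_nonneg_right this ht0
    by_contra! hle
    have hz : v.2 = 0 := by nlinarith [sq_nonneg v.2]
    have hq : a ^ 2 + b ^ 2 - c ^ 2 = 0 := by nlinarith [sq_nonneg v.2]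
    rw [hq, mul_zero] at hid
    have ha : a = 0 := by nlinarith [sq_nonneg a, sq_nonneg b, sq_nonneg (a * y - b * x)]
    have hb' : b = 0 := by nlinarith [sq_nonneg a, sq_nonneg b, sq_nonneg (a * y - b * x)]
    have hc : c = 0 := by rw [ha, hb'] at hq; nlinarith
    tauto

/-- Expansion of the metric in a frame that is orthonormal up to signs. -/
theorem form_eq_sum_frame {κ : ℝ} {e : Fin 4 → Ambient} {s : Fin 4 → ℝ} (hs : ∀ i, s i * s i = 1)
    (he : ∀ i j, form κ (e i) (e j) = if i = j then s i else 0) (v w : Ambient) :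
    form κ v w = ∑ i, s i * form κ v (e i) * form κ (e i) w := by
  have hcomb : ∀ (c : Fin 4 → ℝ) (j : Fin 4), form κ (∑ i, c i • e i) (e j) = c j * s j := by
    intro c j
    simp only [form_sum_left, form_smul_left, he, mul_ite, mul_zero, Finset.sum_ite_eq',
      Finset.mem_univ, if_true]
  have hs0 : ∀ i, s i ≠ 0 := fun i h => by simpa [h] using hs i
  have hli : LinearIndependent ℝ e := by
    rw [Fintype.linearIndependent_iff]
    intro c hc j
    have h1 := hcomb c j
    rw [hc] at h1
    have h2 : form κ 0 (e j) = 0 := by simp [form]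
    rw [h2] at h1
    exact (mul_eq_zero.1 h1.symm).resolve_right (hs0 j)
  let B := basisOfLinearIndependentOfCardEqFinrank hli (by simp)
  have hB : ∑ i, B.repr v i • e i = v := by
    have := B.sum_repr v
    simpa [B] using this
  have hc : ∀ j, form κ v (e j) = B.repr v j * s j := fun j => by
    conv_lhs => rw [← hB]
    exact hcomb _ j
  conv_lhs => rw [← hB]
  simp only [form_sum_left, form_smul_left, hc]
  refine Finset.sum_congr rfl fun i _ => ?_
  linear_combination -(B.repr v i * form κ (e i) w) * hs i

section GramSchmidt

variable {V : Type*} [NormedAddCommGroup V] [InnerProductSpace ℝ V]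

/-- Gram–Schmidt for a positive definite bilinear form on a plane. -/
theorem exists_orthonormal_pair (g : V →ₗ[ℝ] V →ₗ[ℝ] ℝ) (hsymm : ∀ v w, g v w = g w v)
    (hpos : ∀ v, v ≠ 0 → 0 < g v v) (hdim : Module.finrank ℝ V = 2) :
    ∃ ζ : Fin 2 → V, ∀ i j, g (ζ i) (ζ j) = if i = j then 1 else 0 := by
  have : FiniteDimensional ℝ V := Module.finite_of_finrank_pos (by omega)
  let b := Module.finBasisOfFinrankEq ℝ V hdim
  have hunit : ∀ v, v ≠ 0 → g ((√(g v v))⁻¹ • v) ((√(g v v))⁻¹ • v) = 1 := by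
    intro v hv
    have h1 := hpos v hv
    have h2 : √(g v v) ≠ 0 := (Real.sqrt_pos.2 h1).ne'
    simp only [map_smul, LinearMap.smul_apply, smul_eq_mul]
    field_simp
    exact (Real.sq_sqrt h1.le).symm
  set p := (√(g (b 0) (b 0)))⁻¹ • b 0 with hp
  have hpp : g p p = 1 := hunit _ (b.ne_zero 0)
  set q := b 1 - g (b 1) p • p with hq
  have hq0 : q ≠ 0 := by
    intro h
    have h1 : b 1 + (-(g (b 1) p * (√(g (b 0) (b 0)))⁻¹)) • b 0 = 0 := by
      rw [← h, hq, hp]; simp only [smul_smul, neg_smul]; abel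
    have h2 := congrArg (fun v => b.repr v 1) h1
    simp at h2
  have hqp : g q p = 0 := by simp [hq, hpp]
  set q' := (√(g q q))⁻¹ • q with hq'
  have hq'p : g q' p = 0 := by simp [hq', hqp]
  refine ⟨![p, q'], fun i j => ?_⟩
  fin_cases i <;> fin_cases j
  · simpa using hpp
  · simpa using (hsymm p q').trans hq'p
  · simpa using hq'p
  · exact hunit q hq0

/-- A pair that is orthonormal for a bilinear form `g ≤ Λ ‖·‖²` cannot be too small: this is the
lower ellipticity bound of the operator `u ↦ ∑ D²u(ζ k, ζ k)`. -/
theorem norm_sq_le_of_orthonormal_pair (g : V →ₗ[ℝ] V →ₗ[ℝ] ℝ)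
    (hdim : Module.finrank ℝ V = 2) {Λ : ℝ} (hΛ : ∀ v, g v v ≤ Λ * ‖v‖ ^ 2)
    {ζ : Fin 2 → V} (hζ : ∀ i j, g (ζ i) (ζ j) = if i = j then 1 else 0) (w : V) :
    ‖w‖ ^ 2 ≤ Λ * ∑ k, inner ℝ w (ζ k) ^ 2 := by
  have hcomb : ∀ (c : Fin 2 → ℝ) (j : Fin 2), g (∑ i, c i • ζ i) (ζ j) = c j := by
    intro c j
    fin_cases j <;> simp [hζ]
  have hli : LinearIndependent ℝ ζ := by
    rw [Fintype.linearIndependent_iff]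
    intro c hc j
    have h1 := hcomb c j
    rw [hc] at h1
    simpa using h1.symm
  let B := basisOfLinearIndependentOfCardEqFinrank hli (by simp [hdim])
  have hB : ∑ i, B.repr w i • ζ i = w := by
    have := B.sum_repr w
    simpa [B] using this
  set c := fun i => B.repr w i with hc
  have h1 : ‖w‖ ^ 2 = c 0 * inner ℝ w (ζ 0) + c 1 * inner ℝ w (ζ 1) := by
    rw [← real_inner_self_eq_norm_sq]
    conv_lhs => arg 3; rw [← hB]
    simp [Fin.sum_univ_two, inner_add_right, inner_smul_right, hc]
  have h2 : g w w = c 0 ^ 2 + c 1 ^ 2 := by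
    conv_lhs => arg 2; rw [← hB]
    have h0 : ∀ j, g w (ζ j) = c j := fun j => by
      conv_lhs => rw [← hB]
      exact hcomb _ j
    simp [Fin.sum_univ_two, h0, hc]
    ring
  have h3 := hΛ w
  rw [Fin.sum_univ_two]
  set a := inner ℝ w (ζ 0)
  set b := inner ℝ w (ζ 1)
  rcases (sq_nonneg ‖w‖).eq_or_lt with h0 | h0
  · have : w = 0 := by simpa using h0.symm
    have ha : a = 0 := by simp [a, this]
    have hb : b = 0 := by simp [b, this]
    simp [this, ha, hb]
  · have h4 : (‖w‖ ^ 2) ^ 2 ≤ (c 0 ^ 2 + c 1 ^ 2) * (a ^ 2 + b ^ 2) := by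
      rw [h1]; nlinarith [sq_nonneg (c 0 * b - c 1 * a)]
    have h5 : (c 0 ^ 2 + c 1 ^ 2) * (a ^ 2 + b ^ 2) ≤ Λ * ‖w‖ ^ 2 * (a ^ 2 + b ^ 2) := by
      gcongr; linarith
    exact le_of_mul_le_mul_right (by nlinarith) h0

end GramSchmidt

end ProductSurface

/-! ### Surfaces in a chart -/

namespace ProductSurface

/-- The coordinate plane. -/
abbrev Plane : Type := EuclideanSpace ℝ (Fin 2)

/-- A `C²` immersion `F` of an open set `U` of the plane into `𝕄²(κ) × ℝ`: a surface seen in a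
chart. -/
structure IsPatch (κ : ℝ) (U : Set Plane) (F : Plane → Ambient) : Prop where
  isOpen : IsOpen U
  mem : ∀ x ∈ U, F x ∈ space κ
  contDiffOn : ContDiffOn ℝ 2 F U
  immersion : ∀ x ∈ U, Function.Injective (fderiv ℝ F x)

/-- The pair `ζ` is orthonormal at `x` for the first fundamental form of `F`. -/
def IsFrameAt (κ : ℝ) (F : Plane → Ambient) (x : Plane) (ζ : Fin 2 → Plane) : Prop :=
  ∀ i j, form κ (fderiv ℝ F x (ζ i)) (fderiv ℝ F x (ζ j)) = if i = j then 1 else 0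

/-- An `H`-surface seen in a chart. The mean curvature equation is stated without coordinates: twice
the mean curvature is the trace of the second fundamental form in every orthonormal frame. -/
structure IsHPatch (κ : ℝ) (H : ℝ → ℝ) (U : Set Plane) (F N : Plane → Ambient) : Prop
    extends IsPatch κ U F where
  contDiffOn_normal : ContDiffOn ℝ 1 N U
  tangent : ∀ x ∈ U, form κ (N x) (radial (F x)) = 0
  normal : ∀ x ∈ U, ∀ v, form κ (N x) (fderiv ℝ F x v) = 0
  unit : ∀ x ∈ U, form κ (N x) (N x) = 1
  mean : ∀ x ∈ U, ∀ ζ, IsFrameAt κ F x ζ →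
    ∑ k, -form κ (fderiv ℝ N x (ζ k)) (fderiv ℝ F x (ζ k)) = 2 * H (N x).2

section IsPatch

variable {κ : ℝ} {U : Set Plane} {F : Plane → Ambient}

theorem IsPatch.contDiffAt (h : IsPatch κ U F) {x : Plane} (hx : x ∈ U) : ContDiffAt ℝ 2 F x :=
  h.contDiffOn.contDiffAt (h.isOpen.mem_nhds hx)

theorem IsPatch.differentiableAt (h : IsPatch κ U F) {x : Plane} (hx : x ∈ U) :
    DifferentiableAt ℝ F x := (h.contDiffAt hx).differentiableAt (by simp)

theorem IsPatch.continuousOn_fderiv (h : IsPatch κ U F) : ContinuousOn (fderiv ℝ F) U :=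
  h.contDiffOn.continuousOn_fderiv_of_isOpen h.isOpen (by norm_num)

theorem IsPatch.differentiableAt_fderiv (h : IsPatch κ U F) {x : Plane} (hx : x ∈ U) :
    DifferentiableAt ℝ (fderiv ℝ F) x :=
  ((h.contDiffAt hx).fderiv_right (m := 1) (by norm_num)).differentiableAt (by simp)

theorem IsPatch.continuousOn_fderiv_fderiv (h : IsPatch κ U F) :
    ContinuousOn (fderiv ℝ (fderiv ℝ F)) U :=
  (h.contDiffOn.fderiv_of_isOpen h.isOpen (m := 1) (by norm_num)).continuousOn_fderiv_of_isOpen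
    h.isOpen le_rfl

theorem fderiv_radial_comp {x : Plane} (hF : DifferentiableAt ℝ F x) :
    DifferentiableAt ℝ (fun y => radial (F y)) x ∧
      ∀ v, fderiv ℝ (fun y => radial (F y)) x v = radial (fderiv ℝ F x v) := by
  have h := hF.hasFDerivAt.fst.prodMk (hasFDerivAt_const (0 : ℝ) x)
  have h' : HasFDerivAt (fun y => radial (F y)) _ x := h
  refine ⟨h'.differentiableAt, fun v => ?_⟩
  rw [h'.fderiv]
  rfl

theorem IsPatch.form_fderiv_radial (h : IsPatch κ U F) (hκ : κ = 1 ∨ κ = -1) {x : Plane}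
    (hx : x ∈ U) (v : Plane) : form κ (fderiv ℝ F x v) (radial (F x)) = 0 := by
  obtain ⟨hd, hv⟩ := fderiv_radial_comp (h.differentiableAt hx)
  have hc : (fun y => form κ (radial (F y)) (radial (F y))) =ᶠ[𝓝 x] fun _ => κ :=
    Filter.mem_of_superset (h.isOpen.mem_nhds hx) fun y hy => form_radial_self hκ (h.mem y hy)
  have h1 := fderiv_form (κ := κ) hd hd v
  rw [hc.fderiv_eq, hv, form_comm κ (radial (F x)), form_radial_radial] at h1
  simp at h1
  linarith

theorem IsPatch.form_fderiv_pos (h : IsPatch κ U F) (hκ : κ = 1 ∨ κ = -1) {x : Plane}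
    (hx : x ∈ U) {v : Plane} (hv : v ≠ 0) : 0 < form κ (fderiv ℝ F x v) (fderiv ℝ F x v) := by
  refine form_self_pos hκ (h.mem x hx) (h.form_fderiv_radial hκ hx v) fun h0 => hv ?_
  exact h.immersion x hx (h0.trans (map_zero _).symm)

/-- The first fundamental form at `x`. -/
noncomputable def metricBilin (κ : ℝ) (F : Plane → Ambient) (x : Plane) :
    Plane →ₗ[ℝ] Plane →ₗ[ℝ] ℝ :=
  (formBilin κ).compl₁₂ (fderiv ℝ F x : Plane →ₗ[ℝ] Ambient) (fderiv ℝ F x : Plane →ₗ[ℝ] Ambient)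

theorem IsPatch.exists_frame (h : IsPatch κ U F) (hκ : κ = 1 ∨ κ = -1) {x : Plane} (hx : x ∈ U) :
    ∃ ζ, IsFrameAt κ F x ζ :=
  exists_orthonormal_pair (metricBilin κ F x) (fun _ _ => form_comm _ _ _)
    (fun _ hv => h.form_fderiv_pos hκ hx hv) (by simp)

/-- Bounds on the derivatives and on the first fundamental form, uniform near a point. -/
theorem IsPatch.exists_bounds (h : IsPatch κ U F) (hκ : κ = 1 ∨ κ = -1) {x₀ : Plane}
    (hx₀ : x₀ ∈ U) : ∃ W ⊆ U, IsOpen W ∧ x₀ ∈ W ∧ ∃ M > 0, ∃ lam > 0, ∀ x ∈ W,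
      ‖fderiv ℝ F x‖ ≤ M ∧ ‖fderiv ℝ (fderiv ℝ F) x‖ ≤ M ∧
      ∀ v, lam * ‖v‖ ^ 2 ≤ form κ (fderiv ℝ F x v) (fderiv ℝ F x v) := by
  obtain ⟨r, hr, hrU⟩ := Metric.isOpen_iff.1 h.isOpen x₀ hx₀
  have hK : closedBall x₀ (r / 2) ⊆ U := (closedBall_subset_ball (by linarith)).trans hrU
  have hKc := isCompact_closedBall x₀ (r / 2)
  obtain ⟨M₁, hM₁⟩ := hKc.exists_bound_of_continuousOn (h.continuousOn_fderiv.mono hK)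
  obtain ⟨M₂, hM₂⟩ := hKc.exists_bound_of_continuousOn (f := fderiv ℝ (fderiv ℝ F))
    (h.continuousOn_fderiv_fderiv.mono hK)
  have hq : ContinuousOn (fun p : Plane × Plane =>
      form κ (fderiv ℝ F p.1 p.2) (fderiv ℝ F p.1 p.2))
      (closedBall x₀ (r / 2) ×ˢ sphere (0 : Plane) 1) := by
    have h1 : ContinuousOn (fun p : Plane × Plane => fderiv ℝ F p.1 p.2)
        (closedBall x₀ (r / 2) ×ˢ sphere (0 : Plane) 1) :=
      ((h.continuousOn_fderiv.mono hK).comp continuousOn_fst fun p hp => hp.1).clm_apply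
        continuousOn_snd
    exact (continuous_form κ).comp_continuousOn (h1.prodMk h1)
  obtain ⟨p, hp, hpm⟩ := (hKc.prod (isCompact_sphere (0 : Plane) 1)).exists_isMinOn
    ⟨(x₀, EuclideanSpace.single 0 1), mem_closedBall_self (by linarith), by simp⟩ hq
  refine ⟨ball x₀ (r / 2), ball_subset_closedBall.trans hK, isOpen_ball,
    mem_ball_self (by linarith), max 1 (max M₁ M₂), by positivity, _,
    h.form_fderiv_pos hκ (hK hp.1) (v := p.2) ?_, fun x hx => ⟨?_, ?_, fun v => ?_⟩⟩
  · rintro h0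
    have := hp.2
    rw [h0] at this
    simp at this
  · exact (hM₁ x (ball_subset_closedBall hx)).trans (by simp)
  · exact (hM₂ x (ball_subset_closedBall hx)).trans (by simp)
  · rcases eq_or_ne v 0 with rfl | hv
    · simp [form]
    have hv0 : ‖v‖ ≠ 0 := norm_ne_zero_iff.2 hv
    have h1 := hpm (show (x, ‖v‖⁻¹ • v) ∈ closedBall x₀ (r / 2) ×ˢ sphere (0 : Plane) 1 from
      ⟨ball_subset_closedBall hx, by simp [norm_smul, hv0]⟩)
    simp only [mem_ofPred_eq, map_smul, form_smul_left] at h1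
    rw [form_comm κ _ (_ • _), form_smul_left] at h1
    calc _ ≤ _ := mul_le_mul_of_nonneg_right h1 (sq_nonneg ‖v‖)
      _ = _ := by field_simp

theorem IsPatch.fderiv_clm (h : IsPatch κ U F) (l : Ambient →L[ℝ] ℝ) {x : Plane}
    (hx : x ∈ U) : fderiv ℝ (fun y => l (F y)) x = l ∘L fderiv ℝ F x :=
  (l.hasFDerivAt.comp x (h.differentiableAt hx).hasFDerivAt).fderiv

theorem IsPatch.fderiv_fderiv_clm (h : IsPatch κ U F) (l : Ambient →L[ℝ] ℝ) {x : Plane}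
    (hx : x ∈ U) (v w : Plane) :
    fderiv ℝ (fderiv ℝ (fun y => l (F y))) x v w = l (fderiv ℝ (fderiv ℝ F) x v w) := by
  have h1 : fderiv ℝ (fun y => l (F y)) =ᶠ[𝓝 x] fun y => l ∘L fderiv ℝ F y :=
    Filter.mem_of_superset (h.isOpen.mem_nhds hx) fun y hy => h.fderiv_clm l hy
  have h2 := (ContinuousLinearMap.compL ℝ Plane Ambient ℝ l).hasFDerivAt.comp x
    (h.differentiableAt_fderiv hx).hasFDerivAt
  have h3 : HasFDerivAt (fun y => l ∘L fderiv ℝ F y) _ x := h2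
  rw [h1.fderiv_eq, h3.fderiv]
  rfl

end IsPatch

section IsHPatch

variable {κ : ℝ} {H : ℝ → ℝ} {U : Set Plane} {F N : Plane → Ambient}

/-- The second fundamental form as the normal component of the second derivative. -/
theorem IsHPatch.form_fderiv_normal (h : IsHPatch κ H U F N) {x : Plane} (hx : x ∈ U) (v : Plane) :
    -form κ (fderiv ℝ N x v) (fderiv ℝ F x v) = form κ (fderiv ℝ (fderiv ℝ F) x v v) (N x) := by
  have hN : DifferentiableAt ℝ N x :=
    (h.contDiffOn_normal.contDiffAt (h.isOpen.mem_nhds hx)).differentiableAt (by simp)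
  have hD := (ContinuousLinearMap.apply ℝ Ambient v).hasFDerivAt.comp x
    (h.differentiableAt_fderiv hx).hasFDerivAt
  have hD' : HasFDerivAt (fun y => fderiv ℝ F y v) _ x := hD
  have h1 := fderiv_form (κ := κ) hN hD'.differentiableAt v
  have hc : (fun y => form κ (N y) (fderiv ℝ F y v)) =ᶠ[𝓝 x] fun _ => 0 :=
    Filter.mem_of_superset (h.isOpen.mem_nhds hx) fun y hy => h.normal y hy v
  rw [hc.fderiv_eq, hD'.fderiv, form_comm κ (N x)] at h1
  simp at h1
  linarith

/-- The images of `ζ 0, ζ 1` under the differential, the normal `N` and the radial field form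
an orthonormal frame of `ℝ³_κ × ℝ`, up to the square norm `κ` of the last. -/
theorem IsHPatch.form_eq (h : IsHPatch κ H U F N) (hκ : κ = 1 ∨ κ = -1) {x : Plane} (hx : x ∈ U)
    {ζ : Fin 2 → Plane} (hζ : IsFrameAt κ F x ζ) (v w : Ambient) :
    form κ v w = form κ v (fderiv ℝ F x (ζ 0)) * form κ (fderiv ℝ F x (ζ 0)) w +
      form κ v (fderiv ℝ F x (ζ 1)) * form κ (fderiv ℝ F x (ζ 1)) w +
      form κ v (N x) * form κ (N x) w +
      κ * form κ v (radial (F x)) * form κ (radial (F x)) w := by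
  have hκ2 : κ * κ = 1 := by rcases hκ with rfl | rfl <;> norm_num
  have := form_eq_sum_frame (κ := κ)
    (e := ![fderiv ℝ F x (ζ 0), fderiv ℝ F x (ζ 1), N x, radial (F x)]) (s := ![1, 1, 1, κ])
    (fun i => by fin_cases i <;> simp [hκ2]) (fun i j => ?_) v w
  · simpa [Fin.sum_univ_four] using this
  have h1 := h.normal x hx
  have h2 := h.form_fderiv_radial hκ hx
  have h3 := h.tangent x hx
  have h4 := h.unit x hx
  have h5 := form_radial_self hκ (h.mem x hx)
  have h1' := fun v => (form_comm κ (fderiv ℝ F x v) (N x)).trans (h1 v)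
  have h2' := fun v => (form_comm κ (radial (F x)) (fderiv ℝ F x v)).trans (h2 v)
  have h3' := (form_comm κ (radial (F x)) (N x)).trans h3
  have h00 := hζ 0 0
  have h01 := hζ 0 1
  have h10 := hζ 1 0
  have h11 := hζ 1 1
  simp at h00 h01 h10 h11
  fin_cases i <;> fin_cases j <;> simp [h1, h2, h3, h4, h5, h1', h2', h3', h00, h01, h10, h11]

/-- `|∇z|² = 1 - ν²` for the height `z` and the angle `ν`. -/
theorem IsHPatch.sq_add_sq_add_sq (h : IsHPatch κ H U F N) (hκ : κ = 1 ∨ κ = -1) {x : Plane}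
    (hx : x ∈ U) {ζ : Fin 2 → Plane} (hζ : IsFrameAt κ F x ζ) :
    (fderiv ℝ F x (ζ 0)).2 ^ 2 + (fderiv ℝ F x (ζ 1)).2 ^ 2 + (N x).2 ^ 2 = 1 := by
  have h1 := h.form_eq hκ hx hζ vertical vertical
  simp only [form_comm κ vertical, form_vertical] at h1
  simp only [vertical, radial, mul_zero, add_zero] at h1
  linarith

/-- The height `z` satisfies `∑ D²z(ζ k, ζ k) = ∑ c k * Dz(ζ k) + 2 H(ν) ν`. -/
theorem IsHPatch.sum_fderiv_fderiv_snd (h : IsHPatch κ H U F N) (hκ : κ = 1 ∨ κ = -1) {x : Plane}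
    (hx : x ∈ U) {ζ : Fin 2 → Plane} (hζ : IsFrameAt κ F x ζ) :
    ∑ k, (fderiv ℝ (fderiv ℝ F) x (ζ k) (ζ k)).2 =
      ∑ j, (∑ k, form κ (fderiv ℝ (fderiv ℝ F) x (ζ k) (ζ k)) (fderiv ℝ F x (ζ j))) *
        (fderiv ℝ F x (ζ j)).2 + 2 * H (N x).2 * (N x).2 := by
  have h1 : ∀ k, (fderiv ℝ (fderiv ℝ F) x (ζ k) (ζ k)).2 = _ := fun k =>
    (form_vertical κ _).symm.trans
      (h.form_eq hκ hx hζ (fderiv ℝ (fderiv ℝ F) x (ζ k) (ζ k)) vertical)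
  have h2 := h.mean x hx ζ hζ
  simp only [h.form_fderiv_normal hx] at h2
  simp only [form_vertical] at h1
  simp only [radial, mul_zero, add_zero] at h1
  simp only [Fin.sum_univ_two] at h2 ⊢
  rw [h1 0, h1 1, ← h2]
  ring

/-- At a critical point of the height the surface is horizontal. -/
theorem IsHPatch.normal_snd_sq (h : IsHPatch κ H U F N) (hκ : κ = 1 ∨ κ = -1) {x : Plane}
    (hx : x ∈ U) (hcrit : ∀ v, (fderiv ℝ F x v).2 = 0) : (N x).2 ^ 2 = 1 := by
  obtain ⟨ζ, hζ⟩ := h.exists_frame hκ hx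
  simpa [hcrit] using h.sq_add_sq_add_sq hκ hx hζ

variable (σ : ℝ)

/-- The height multiplied by `σ`, as a continuous linear map; `σ = -1` exchanges maxima and
minima. -/
noncomputable def heightCLM : Ambient →L[ℝ] ℝ := σ • ContinuousLinearMap.snd ℝ (Fin 3 → ℝ) ℝ

variable {σ}

@[simp] theorem heightCLM_apply (v : Ambient) : heightCLM σ v = σ * v.2 := rfl

theorem IsPatch.crit_of_isLocalMax (h : IsPatch κ U F) (hσ : σ ≠ 0) {x : Plane} (hx : x ∈ U)
    (hmax : IsLocalMax (fun y => heightCLM σ (F y)) x) (v : Plane) : (fderiv ℝ F x v).2 = 0 := by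
  have h1 := hmax.fderiv_eq_zero
  rw [h.fderiv_clm _ hx] at h1
  have h2 := congrArg (fun l : Plane →L[ℝ] ℝ => l v) h1
  simpa [hσ] using h2

/-- Comparison with the horizontal slice at an extremum of the height. -/
theorem IsHPatch.mul_nonpos_of_isLocalMax (h : IsHPatch κ H U F N) (hκ : κ = 1 ∨ κ = -1)
    (hσ : σ ≠ 0) {x : Plane} (hx : x ∈ U) (hmax : IsLocalMax (fun y => heightCLM σ (F y)) x) :
    σ * (H (N x).2 * (N x).2) ≤ 0 := by
  obtain ⟨ζ, hζ⟩ := h.exists_frame hκ hx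
  have hcrit := h.crit_of_isLocalMax hσ hx hmax
  have h1 := h.sum_fderiv_fderiv_snd hκ hx hζ
  have hC : ContDiffAt ℝ 2 (fun y => heightCLM σ (F y)) x :=
    (heightCLM σ).contDiff.contDiffAt.comp x (h.contDiffAt hx)
  have h2 : ∀ k, σ * (fderiv ℝ (fderiv ℝ F) x (ζ k) (ζ k)).2 ≤ 0 := fun k => by
    have := hmax.fderiv_fderiv_nonpos hC (ζ k)
    rwa [h.fderiv_fderiv_clm _ hx] at this
  simp only [Fin.sum_univ_two, hcrit, mul_zero, add_zero, zero_add] at h1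
  have h3 := congrArg (fun t => σ * t) h1
  simp only [mul_add] at h3
  linarith [h2 0, h2 1]

/-- At a zero `ε = ±1` of `H`, one has `|H ν| ≤ L |ν - ε|` and `|ν - ε| ≤ 1 - ν²`; the right side is
`|∇z|²`, written `a² + b²` here. -/
theorem abs_curvature_mul_angle_le {L : NNReal} (hL : LipschitzOnWith L H (Icc (-1) 1))
    {a b ν ε : ℝ} (hsum : a ^ 2 + b ^ 2 + ν ^ 2 = 1) (hε : ε ^ 2 = 1) (hν : 0 < ε * ν)
    (hH : H ε = 0) : |2 * H ν * ν| ≤ 2 * L * (|a| + |b|) := by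
  have hν1 : ν ∈ Icc (-1 : ℝ) 1 := abs_le.1 (abs_le_one_iff_mul_self_le_one.2
    (by nlinarith [sq_nonneg a, sq_nonneg b]))
  have ha1 : |a| ≤ 1 := abs_le_one_iff_mul_self_le_one.2 (by nlinarith [sq_nonneg ν, sq_nonneg b])
  have hb1 : |b| ≤ 1 := abs_le_one_iff_mul_self_le_one.2 (by nlinarith [sq_nonneg ν, sq_nonneg a])
  have hdist : |ν - ε| ≤ |a| + |b| := by
    have h3 : |ν - ε| ≤ a ^ 2 + b ^ 2 := by
      rcases sq_eq_one_iff.mp hε with h0 | h0 <;> rw [h0] at hν ⊢ <;> rw [abs_le] <;>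
        constructor <;> nlinarith [hν1.1, hν1.2]
    have h4 : a ^ 2 ≤ |a| := by rw [← sq_abs]; nlinarith [abs_nonneg a]
    have h5 : b ^ 2 ≤ |b| := by rw [← sq_abs]; nlinarith [abs_nonneg b]
    linarith
  have hε1 : ε ∈ Icc (-1 : ℝ) 1 := abs_le.1 (abs_le_one_iff_mul_self_le_one.2 (by nlinarith))
  have h3 := hL.dist_le_mul ν hν1 ε hε1
  rw [hH, Real.dist_eq, Real.dist_eq, sub_zero] at h3
  rw [abs_mul, abs_mul, abs_two]
  calc 2 * |H ν| * |ν| ≤ 2 * |H ν| * 1 := by gcongr; exact abs_le.2 hν1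
    _ ≤ 2 * (L * |ν - ε|) := by linarith
    _ ≤ 2 * (L * (|a| + |b|)) := by gcongr
    _ = _ := by ring

theorem neg_le_of_abs_le {σ c₀ c₁ a b d B L C : ℝ} (hσ : |σ| = 1) (hc₀ : |c₀| ≤ B) (hc₁ : |c₁| ≤ B)
    (hd : |d| ≤ 2 * L * (|a| + |b|)) (hC : B + 2 * L ≤ C) :
    -(C * (|a| + |b|)) ≤ σ * (c₀ * a + c₁ * b + d) := by
  have h1 := (abs_mul c₀ a).trans_le (mul_le_mul_of_nonneg_right hc₀ (abs_nonneg a))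
  have h2 := (abs_mul c₁ b).trans_le (mul_le_mul_of_nonneg_right hc₁ (abs_nonneg b))
  have h3 := abs_add_le (c₀ * a) (c₁ * b)
  have h4 := abs_add_le (c₀ * a + c₁ * b) d
  have h5 : (B + 2 * L) * (|a| + |b|) ≤ C * (|a| + |b|) := by gcongr
  have h6 : |σ * (c₀ * a + c₁ * b + d)| ≤ C * (|a| + |b|) := by
    rw [abs_mul, hσ, one_mul]; linarith
  exact (abs_le.1 h6).1

/-- The strong maximum principle for the height at a point where the surface is tangent, with the
same orientation, to a horizontal slice that solves the prescribed curvature equation. -/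
theorem IsHPatch.eventually_height_eq (h : IsHPatch κ H U F N) (hκ : κ = 1 ∨ κ = -1)
    {L : NNReal} (hL : LipschitzOnWith L H (Icc (-1) 1)) (hσ : σ ^ 2 = 1) {x₀ : Plane}
    (hx₀ : x₀ ∈ U) (hH : H (N x₀).2 = 0)
    (hmax : ∀ x ∈ U, heightCLM σ (F x) ≤ heightCLM σ (F x₀)) :
    ∀ᶠ x in 𝓝 x₀, (F x).2 = (F x₀).2 := by
  have hσ0 : σ ≠ 0 := fun h0 => by simp [h0] at hσ
  have hσ1 : |σ| = 1 := by rcases sq_eq_one_iff.mp hσ with h | h <;> simp [h]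
  have hκ1 : |κ| = 1 := by rcases hκ with rfl | rfl <;> simp
  have hε := h.normal_snd_sq hκ hx₀ (h.crit_of_isLocalMax hσ0 hx₀
    (Filter.mem_of_superset (h.isOpen.mem_nhds hx₀) hmax))
  set ε := (N x₀).2 with hεdef
  obtain ⟨W₁, hW₁U, hW₁o, hW₁, M, hM, lam, hlam, hb⟩ := h.exists_bounds hκ hx₀
  -- Near `x₀` the angle stays on the same side as `ε = ±1`.
  have hNc : ContinuousAt (fun x => ε * (N x).2) x₀ := continuousAt_const.mul
    (h.contDiffOn_normal.continuousOn.continuousAt (h.isOpen.mem_nhds hx₀)).snd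
  have hpos : ∀ᶠ x in 𝓝 x₀, 0 < ε * (N x).2 :=
    hNc.eventually (lt_mem_nhds (show 0 < ε * (N x₀).2 by rw [← hεdef]; nlinarith))
  obtain ⟨W₂, hW₂s, hW₂o, hW₂⟩ := _root_.eventually_nhds_iff.1 hpos
  set A := (√lam)⁻¹ with hA
  have hA0 : 0 < A := inv_pos.2 (Real.sqrt_pos.2 hlam)
  set C := max A (2 * (4 * (M * A * A * (M * A))) + 2 * L) with hC
  have hAC : A ≤ C := le_max_left _ _
  have key := eventually_eq_of_isMaxOn_of_elliptic (u := fun y => heightCLM σ (F y))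
    (U := W₁ ∩ W₂) (C := C) (c := (4 * (M * M))⁻¹) (x₀ := x₀) (hW₁o.inter hW₂o) ?_
    (hA0.le.trans hAC) (by positivity) ?_ ⟨hW₁, hW₂⟩ (fun x hx => hmax x (hW₁U hx.1))
  · filter_upwards [key] with x hx
    exact mul_left_cancel₀ hσ0 hx
  · exact (heightCLM σ).contDiff.comp_contDiffOn (h.contDiffOn.mono (inter_subset_left.trans hW₁U))
  rintro x ⟨hxW₁, hxW₂⟩
  have hx := hW₁U hxW₁
  obtain ⟨ζ, hζ⟩ := h.exists_frame hκ hx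
  obtain ⟨hM1, hM2, hlow⟩ := hb x hxW₁
  have hζA : ∀ k, ‖ζ k‖ ≤ A := fun k => by
    have h1 := hlow (ζ k)
    rw [hζ k k, if_pos rfl] at h1
    rw [hA, ← Real.sqrt_inv]
    refine Real.le_sqrt_of_sq_le ?_
    rw [inv_eq_one_div, le_div_iff₀ hlam]
    linarith
  have hDF : ∀ k, ‖fderiv ℝ F x (ζ k)‖ ≤ M * A := fun k =>
    (ContinuousLinearMap.le_opNorm _ _).trans (by gcongr; exact hζA k)
  have hDDF : ∀ k, ‖fderiv ℝ (fderiv ℝ F) x (ζ k) (ζ k)‖ ≤ M * A * A := fun k =>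
    (ContinuousLinearMap.le_opNorm₂ _ _ _).trans (by gcongr <;> exact hζA k)
  refine ⟨ζ, fun k => (hζA k).trans hAC, fun w => ?_, ?_⟩
  · have := norm_sq_le_of_orthonormal_pair (metricBilin κ F x) (by simp) (Λ := 4 * (M * M))
      (fun v => ?_) hζ w
    · rwa [inv_mul_le_iff₀ (by positivity)]
    · have h1 := (le_abs_self _).trans (abs_form_le hκ1 (fderiv ℝ F x v) (fderiv ℝ F x v))
      have h2 : ‖fderiv ℝ F x v‖ ≤ M * ‖v‖ :=
        (ContinuousLinearMap.le_opNorm _ _).trans (by gcongr)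
      calc _ ≤ _ := h1
        _ ≤ 4 * ((M * ‖v‖) * (M * ‖v‖)) := by gcongr
        _ = _ := by ring
  · simp only [h.fderiv_clm _ hx, h.fderiv_fderiv_clm _ hx]
    simp only [ContinuousLinearMap.comp_apply, heightCLM_apply, abs_mul, hσ1, one_mul,
      ← Finset.mul_sum]
    have h1 := h.sum_fderiv_fderiv_snd hκ hx hζ
    have h2 := h.sq_add_sq_add_sq hκ hx hζ
    have hc : ∀ j, |∑ k, form κ (fderiv ℝ (fderiv ℝ F) x (ζ k) (ζ k)) (fderiv ℝ F x (ζ j))| ≤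
        2 * (4 * (M * A * A * (M * A))) := fun j => by
      have h3 : ∀ k, |form κ (fderiv ℝ (fderiv ℝ F) x (ζ k) (ζ k)) (fderiv ℝ F x (ζ j))| ≤
          4 * (M * A * A * (M * A)) := fun k =>
        (abs_form_le hκ1 _ _).trans (by gcongr; exacts [hDDF k, hDF j])
      rw [Fin.sum_univ_two]
      exact (abs_add_le _ _).trans (by linarith [h3 0, h3 1])
    rw [h1]
    simp only [Fin.sum_univ_two] at hc ⊢
    exact neg_le_of_abs_le hσ1 (hc 0) (hc 1)
      (abs_curvature_mul_angle_le hL h2 hε (hW₂s x hxW₂) hH) (le_max_right _ _)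

end IsHPatch

end ProductSurface

/-! ### From the manifold to charts -/

namespace ProductSurface

/-- The trace of `I⁻¹ II` is the trace of `II` in any frame orthonormal for `I`. -/
theorem trace_inv_mul_eq_sum {I II : Matrix (Fin 2) (Fin 2) ℝ} {X : Matrix (Fin 2) (Fin 2) ℝ}
    (h : X.transpose * I * X = 1) :
    (I⁻¹ * II).trace = (X.transpose * II * X).trace := by
  have h1 : X * X.transpose * I = 1 := by
    rw [Matrix.mul_assoc]; exact mul_eq_one_comm.1 h
  rw [Matrix.inv_eq_left_inv h1, Matrix.mul_assoc, Matrix.trace_mul_comm]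

theorem sum_smul_single (v : Plane) :
    ∑ i, v i • (EuclideanSpace.single i (1 : ℝ) : Plane) = v := by
  ext j
  fin_cases j <;> simp

theorem form_map_eq_sum (κ : ℝ) (A B : Plane →L[ℝ] Ambient) (v w : Plane) :
    form κ (A v) (B w) = ∑ i, ∑ j, v i * form κ (A (EuclideanSpace.single i 1))
      (B (EuclideanSpace.single j 1)) * w j := by
  conv_lhs => rw [← sum_smul_single v, ← sum_smul_single w]
  simp only [← formBilin_apply, map_sum, map_smul, LinearMap.sum_apply, LinearMap.smul_apply,
    smul_eq_mul, Finset.mul_sum]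
  rw [Finset.sum_comm]
  exact Finset.sum_congr rfl fun i _ => Finset.sum_congr rfl fun j _ => by ring

variable {S : Type*} [TopologicalSpace S] [ChartedSpace (EuclideanSpace ℝ (Fin 2)) S]

/-- The mean curvature as the trace of the second fundamental form in an orthonormal frame. -/
theorem two_mul_meanCurvature {κ : ℝ} {f η : S → Ambient} {p : S} {T B : Plane →L[ℝ] Ambient}
    (hT : mfderiv (𝓡 2) 𝓘(ℝ, Ambient) f p = T) (hB : mfderiv (𝓡 2) 𝓘(ℝ, Ambient) η p = B)
    (hrad : ∀ v, form κ (T v) (radial (f p)) = 0) {ξ : Fin 2 → Plane}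
    (hξ : ∀ i j, form κ (T (ξ i)) (T (ξ j)) = if i = j then 1 else 0) :
    2 * meanCurvature κ f η p = ∑ k, -form κ (B (ξ k)) (T (ξ k)) := by
  have hTi : ∀ i, partialD f p i = T (EuclideanSpace.single i 1) := fun i => by
    rw [partialD, hT]; rfl
  have hBi : ∀ i, partialD η p i = B (EuclideanSpace.single i 1) := fun i => by
    rw [partialD, hB]; rfl
  have hII : ∀ i j, secondForm κ f η p i j =
      -form κ (B (EuclideanSpace.single i 1)) (T (EuclideanSpace.single j 1)) := by
    intro i j
    simp only [secondForm, Matrix.of_apply, tangentProj, form_sub_left, form_smul_left, hTi, hBi]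
    rw [form_comm κ (radial (f p)), hrad, mul_zero, sub_zero]
  have hI : ∀ i j, firstForm κ f p i j =
      form κ (T (EuclideanSpace.single i 1)) (T (EuclideanSpace.single j 1)) := by
    intro i j
    simp only [firstForm, Matrix.of_apply, hTi]
  let X : Matrix (Fin 2) (Fin 2) ℝ := Matrix.of fun i k => ξ k i
  have hX : X.transpose * firstForm κ f p * X = 1 := by
    ext i j
    rw [Matrix.one_apply, ← hξ i j, form_map_eq_sum]
    simp only [Matrix.mul_apply, Matrix.transpose_apply, X, Matrix.of_apply, hI, Finset.sum_mul]
    exact Finset.sum_comm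
  rw [meanCurvature, trace_inv_mul_eq_sum hX, mul_div_cancel₀ _ (two_ne_zero' ℝ), Matrix.trace]
  refine Finset.sum_congr rfl fun k _ => ?_
  rw [form_map_eq_sum]
  simp only [Matrix.diag_apply, Matrix.mul_apply, Matrix.transpose_apply, X, Matrix.of_apply, hII,
    Finset.sum_mul, ← Finset.sum_neg_distrib]
  rw [Finset.sum_comm]
  exact Finset.sum_congr rfl fun i _ => Finset.sum_congr rfl fun j _ => by ring

variable [IsManifold (𝓡 2) 2 S]

/-- The differential of a map and that of its expression in a chart differ by the differential of
the chart. -/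
theorem exists_equiv_mfderiv_eq (p₀ : S) {x : Plane} (hx : x ∈ (extChartAt (𝓡 2) p₀).target) :
    ∃ A : Plane ≃L[ℝ] Plane, ∀ f : S → Ambient, ContMDiff (𝓡 2) 𝓘(ℝ, Ambient) 1 f →
      mfderiv (𝓡 2) 𝓘(ℝ, Ambient) f ((extChartAt (𝓡 2) p₀).symm x) =
        (fderiv ℝ (f ∘ (extChartAt (𝓡 2) p₀).symm) x) ∘L (A : Plane →L[ℝ] Plane) := by
  have : IsManifold (𝓡 2) 1 S := IsManifold.of_le (n := 2) (by norm_num)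
  set φ := extChartAt (𝓡 2) p₀ with hφ
  set q := φ.symm x with hq
  have hqs : q ∈ φ.source := φ.map_target hx
  have hφq : φ q = x := φ.right_inv hx
  obtain ⟨A, hA⟩ := isInvertible_mfderiv_extChartAt (I := 𝓡 2) (x := p₀) hqs
  refine ⟨A, fun f hf => ?_⟩
  have hopen : IsOpen φ.target := isOpen_extChartAt_target p₀
  have hφd : MDifferentiableAt (𝓡 2) 𝓘(ℝ, Plane) φ q :=
    mdifferentiableAt_extChartAt (by simpa [hφ] using hqs)
  have hsymm : ContMDiffOn 𝓘(ℝ, Plane) (𝓡 2) 1 φ.symm φ.target := contMDiffOn_extChartAt_symm p₀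
  have hF : MDifferentiableAt 𝓘(ℝ, Plane) 𝓘(ℝ, Ambient) (f ∘ φ.symm) (φ q) := by
    rw [hφq]
    exact ((hf.comp_contMDiffOn hsymm).contMDiffAt (hopen.mem_nhds hx)).mdifferentiableAt (by simp)
  have heq : f =ᶠ[𝓝 q] (f ∘ φ.symm) ∘ φ := by
    filter_upwards [extChartAt_source_mem_nhds' (I := 𝓡 2) hqs] with y hy
    simp [φ.left_inv hy]
  rw [heq.mfderiv_eq, mfderiv_comp q hF hφd, mfderiv_eq_fderiv, hφq, ← hA]
  rfl

theorem IsImmersedSurface.isPatch {κ : ℝ} {f : S → Ambient} (h : IsImmersedSurface κ f) (p₀ : S) :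
    IsPatch κ (extChartAt (𝓡 2) p₀).target (f ∘ (extChartAt (𝓡 2) p₀).symm) where
  isOpen := isOpen_extChartAt_target p₀
  mem x _ := h.mem _
  contDiffOn := contMDiffOn_iff_contDiffOn.1
    (h.contMDiff.comp_contMDiffOn (contMDiffOn_extChartAt_symm p₀))
  immersion x hx := by
    obtain ⟨A, hA⟩ := exists_equiv_mfderiv_eq p₀ hx
    have h1 := h.immersion ((extChartAt (𝓡 2) p₀).symm x)
    rw [hA f (h.contMDiff.of_le (by norm_num))] at h1
    have h2 := h1.comp A.symm.injective
    intro v w hvw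
    refine h2 ?_
    change fderiv ℝ _ x (A (A.symm v)) = fderiv ℝ _ x (A (A.symm w))
    rw [A.apply_symm_apply, A.apply_symm_apply]
    exact hvw

theorem IsHSurface.isHPatch {κ : ℝ} (hκ : κ = 1 ∨ κ = -1) {H : ℝ → ℝ} {f η : S → Ambient}
    (h : IsHSurface κ H f η) (p₀ : S) :
    IsHPatch κ H (extChartAt (𝓡 2) p₀).target (f ∘ (extChartAt (𝓡 2) p₀).symm)
      (η ∘ (extChartAt (𝓡 2) p₀).symm) where
  toIsPatch := h.immersed.isPatch p₀
  contDiffOn_normal := contMDiffOn_iff_contDiffOn.1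
    (h.unitNormal.contMDiff.comp_contMDiffOn
      ((contMDiffOn_extChartAt_symm (n := 2) p₀).of_le (by norm_num)))
  tangent x _ := h.unitNormal.tangent _
  normal x hx v := by
    obtain ⟨A, hA⟩ := exists_equiv_mfderiv_eq p₀ hx
    have h1 := h.unitNormal.normal ((extChartAt (𝓡 2) p₀).symm x) (A.symm v)
    rw [hA f (h.immersed.contMDiff.of_le (by norm_num))] at h1
    change form κ _ (fderiv ℝ (f ∘ (extChartAt (𝓡 2) p₀).symm) x (A (A.symm v))) = 0 at h1
    rwa [A.apply_symm_apply] at h1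
  unit x _ := h.unitNormal.unit _
  mean x hx ζ hζ := by
    obtain ⟨A, hA⟩ := exists_equiv_mfderiv_eq p₀ hx
    have hP := h.immersed.isPatch p₀
    have h1 := h.meanCurvature_eq ((extChartAt (𝓡 2) p₀).symm x)
    have h2 := two_mul_meanCurvature (κ := κ) (hA f (h.immersed.contMDiff.of_le (by norm_num)))
      (hA η h.unitNormal.contMDiff) (fun v => hP.form_fderiv_radial hκ hx (A v))
      (ξ := fun k => A.symm (ζ k)) (fun i j => by simpa using hζ i j)
    rw [h1, angle, form_vertical] at h2
    simpa using h2.symm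

section Global

variable {κ : ℝ} {H : ℝ → ℝ} {f η : S → Ambient} {σ : ℝ}

theorem IsHSurface.normal_snd_sq (hκ : κ = 1 ∨ κ = -1) (h : IsHSurface κ H f η) (hσ : σ ≠ 0)
    {p : S} (hmax : ∀ q, σ * (f q).2 ≤ σ * (f p).2) : (η p).2 ^ 2 = 1 := by
  have hx := mem_extChartAt_target (I := 𝓡 2) p
  have hp := h.isHPatch hκ p
  simpa using hp.normal_snd_sq hκ hx
    (hp.crit_of_isLocalMax hσ hx (Filter.Eventually.of_forall fun y => by simpa using hmax _))

/-- Comparison with the horizontal slice at the highest (`σ = 1`) or lowest (`σ = -1`) point. -/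
theorem IsHSurface.mul_nonpos_of_isMax (hκ : κ = 1 ∨ κ = -1) (h : IsHSurface κ H f η) (hσ : σ ≠ 0)
    {p : S} (hmax : ∀ q, σ * (f q).2 ≤ σ * (f p).2) : σ * (H (η p).2 * (η p).2) ≤ 0 := by
  simpa using (h.isHPatch hκ p).mul_nonpos_of_isLocalMax hκ hσ (mem_extChartAt_target (I := 𝓡 2) p)
    (Filter.Eventually.of_forall fun y => by simpa using hmax _)

/-- An `H`-surface that touches at an extremum of its height a slice solving the same equation is
contained in the slice. -/
theorem IsHSurface.height_eq [ConnectedSpace S] (hκ : κ = 1 ∨ κ = -1) (h : IsHSurface κ H f η)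
    (hH : ContDiffOn ℝ 1 H (Icc (-1) 1)) (hσ : σ ^ 2 = 1) {p : S}
    (hmax : ∀ q, σ * (f q).2 ≤ σ * (f p).2) (hHp : H (η p).2 = 0) (q : S) :
    (f q).2 = (f p).2 := by
  obtain ⟨L, hL⟩ := hH.exists_lipschitzOnWith one_ne_zero (convex_Icc _ _) isCompact_Icc
  have hσ0 : σ ≠ 0 := fun h0 => by simp [h0] at hσ
  have hfc : Continuous f := h.immersed.contMDiff.continuous
  have hηc : Continuous η := h.unitNormal.contMDiff.continuous
  -- The angle is fixed too, since `H` might vanish at `(η p).2` but not at the opposite angle.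
  have hclopen : IsClopen {q | (f q).2 = (f p).2 ∧ (η q).2 = (η p).2} := by
    refine ⟨(isClosed_eq hfc.snd continuous_const).inter (isClosed_eq hηc.snd continuous_const),
      isOpen_iff_mem_nhds.2 ?_⟩
    rintro q ⟨hq1, hq2⟩
    have hx := mem_extChartAt_target (I := 𝓡 2) q
    have hmaxq : ∀ q', σ * (f q').2 ≤ σ * (f q).2 := fun q' => hq1 ▸ hmax q'
    have h1 := (h.isHPatch hκ q).eventually_height_eq hκ hL hσ hx
      (by simpa [hq2] using hHp) (fun x _ => by simpa using hmaxq _)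
    have h2 := (continuousAt_extChartAt (I := 𝓡 2) q).eventually h1
    have hε := h.normal_snd_sq hκ hσ0 hmaxq
    have h3 : ∀ᶠ q' in 𝓝 q, 0 < (η q).2 * (η q').2 :=
      have hc : Continuous fun q' => (η q).2 * (η q').2 := continuous_const.mul hηc.snd
      hc.continuousAt.eventually (lt_mem_nhds (by simp only; rw [← sq, hε]; exact one_pos))
    filter_upwards [h2, h3, extChartAt_source_mem_nhds (I := 𝓡 2) q] with q' h4 h5 h6
    have h7 : (f q').2 = (f q).2 := by
      rwa [Function.comp_apply, Function.comp_apply, (extChartAt (𝓡 2) q).left_inv h6,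
        extChartAt_to_inv] at h4
    refine ⟨h7.trans hq1, ?_⟩
    have h8 := h.normal_snd_sq hκ hσ0 (p := q') (fun r => h7 ▸ hmaxq r)
    rw [← hq2]
    rcases sq_eq_one_iff.1 hε with h9 | h9 <;> rcases sq_eq_one_iff.1 h8 with h10 | h10 <;>
      rw [h9, h10] at h5 ⊢ <;> norm_num at h5
  have := hclopen.eq_univ ⟨p, rfl, rfl⟩
  exact (this ▸ mem_univ q : q ∈ {q | (f q).2 = (f p).2 ∧ (η q).2 = (η p).2}).1

end Global

end ProductSurface

/-! ### Local homeomorphisms onto spheres -/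

section SphereCovering

variable {V : Type*} [NormedAddCommGroup V] [InnerProductSpace ℝ V]

theorem ne_neg_of_norm_eq_one {v : V} (hv : ‖v‖ = 1) : v ≠ -v := by
  intro h
  have h1 : (2 : ℝ) • v = 0 := by rw [two_smul]; nth_rewrite 2 [h]; simp
  have h2 : v = 0 := by simpa using h1
  simp [h2] at hv

theorem stereographic_symm_stereographic {v : V} (hv : ‖v‖ = 1) {y : sphere (0 : V) 1}
    (hy : (y : V) ≠ v) : (stereographic hv).symm (stereographic hv y) = y := by
  refine (stereographic hv).left_inv ?_
  rw [stereographic_source]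
  exact fun h => hy (congrArg Subtype.val h)

/-- A local homeomorphism from a compact connected Hausdorff space to a sphere of dimension at least
`2` is injective. It is a covering map; the lifts of the two inverse stereographic projections agree
on the twice punctured sphere, which is connected, and glue to a global section. -/
theorem IsLocalHomeomorph.injective_of_sphere [FiniteDimensional ℝ V]
    (hdim : 2 < Module.finrank ℝ V) {S : Type*}
    [TopologicalSpace S] [T2Space S] [CompactSpace S] [ConnectedSpace S]
    {g : S → sphere (0 : V) 1} (hg : IsLocalHomeomorph g) : Function.Injective g := by
  have hcov : IsCoveringMap g := isLocalHomeomorph_iff_isCoveringMap.1 hg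
  have : Nontrivial V := Module.nontrivial_of_finrank_pos (R := ℝ) (by omega)
  obtain ⟨p⟩ := (inferInstance : Nonempty S)
  -- A pole `v` such that neither of `±v` is the base point `g p`.
  obtain ⟨v, hv, hvp, hvp'⟩ : ∃ v : V, ‖v‖ = 1 ∧ (g p : V) ≠ v ∧ (g p : V) ≠ -v := by
    have hfr : 0 < Module.finrank ℝ (ℝ ∙ (g p : V))ᗮ := by
      have h1 := Submodule.finrank_add_finrank_orthogonal (ℝ ∙ (g p : V))
      have h2 := finrank_span_singleton (K := ℝ) (ne_zero_of_mem_unit_sphere (g p))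
      omega
    have := Module.nontrivial_of_finrank_pos hfr
    obtain ⟨w, hw⟩ := exists_norm_eq (ℝ ∙ (g p : V))ᗮ (zero_le_one (α := ℝ))
    have horth : inner ℝ (g p : V) (w : V) = 0 :=
      Submodule.mem_orthogonal_singleton_iff_inner_right.1 w.2
    have hw1 : ‖(w : V)‖ = 1 := hw
    exact ⟨w, hw1, fun h => by simp [← h] at horth,
      fun h => by rw [← neg_eq_iff_eq_neg] at h; simp [← h] at horth⟩
  have hlift : ∀ (u : V) (hu : ‖u‖ = 1), (g p : V) ≠ u → ∃ s : C((ℝ ∙ u)ᗮ, S),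
      s (stereographic hu (g p)) = p ∧ ∀ w, g (s w) = (stereographic hu).symm w := by
    intro u hu hup
    let F : C((ℝ ∙ u)ᗮ, sphere (0 : V) 1) :=
      ⟨(stereographic hu).symm, (isOpenEmbedding_stereographic_symm hu).continuous⟩
    obtain ⟨s, ⟨hs1, hs2⟩, -⟩ := hcov.existsUnique_continuousMap_lifts F
      (stereographic hu (g p)) p (stereographic_symm_stereographic hu hup).symm
    exact ⟨s, hs1, fun w => congrFun hs2 w⟩
  have hv' : ‖-v‖ = 1 := by rwa [norm_neg]
  obtain ⟨s, hsp, hs⟩ := hlift v hv hvp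
  obtain ⟨s', hsp', hs'⟩ := hlift (-v) hv' hvp'
  have hcont : ∀ (u : V) (hu : ‖u‖ = 1) (y : sphere (0 : V) 1), (y : V) ≠ u →
      ContinuousAt (stereographic hu) y := fun u hu y hy => by
    refine (stereographic hu).continuousAt ?_
    rw [stereographic_source]
    exact fun h => hy (congrArg Subtype.val h)
  have hagree : ∀ y : sphere (0 : V) 1, (y : V) ≠ v → (y : V) ≠ -v →
      s (stereographic hv y) = s' (stereographic hv' y) := by
    have hconn : IsPreconnected ({0}ᶜ : Set (ℝ ∙ v)ᗮ) := by
      refine (isConnected_compl_singleton_of_one_lt_rank ?_ 0).isPreconnected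
      have h1 := Submodule.finrank_add_finrank_orthogonal (ℝ ∙ v)
      have h2 := finrank_span_singleton (K := ℝ) (v := v) (by rintro rfl; simp at hv)
      rw [← Module.finrank_eq_rank]
      exact_mod_cast (by omega : 1 < Module.finrank ℝ (ℝ ∙ v)ᗮ)
    have hzero : ∀ y : sphere (0 : V) 1, (y : V) ≠ v → (y : V) ≠ -v → stereographic hv y ≠ 0 := by
      intro y hy hy' h0
      have h1 := stereographic_apply_neg (⟨v, by simp [hv]⟩ : sphere (0 : V) 1)
      have h2 := stereographic_symm_stereographic hv hy
      have h3 := stereographic_symm_stereographic hv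
        (y := -(⟨v, by simp [hv]⟩ : sphere (0 : V) 1)) (by
          exact fun h => ne_neg_of_norm_eq_one hv (Eq.symm h))
      rw [h0] at h2
      rw [h1] at h3
      exact hy' (congrArg Subtype.val (h2.symm.trans h3))
    have hpole : ∀ w : (ℝ ∙ v)ᗮ, w ≠ 0 → ((stereographic hv).symm w : V) ≠ -v := by
      intro w hw h
      apply hw
      have h1 := stereographic_apply_neg (⟨v, by simp [hv]⟩ : sphere (0 : V) 1)
      have h2 : (stereographic hv).symm w = -(⟨v, by simp [hv]⟩ : sphere (0 : V) 1) := Subtype.ext h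
      have h3 := (stereographic hv).right_inv (x := w) (by simp)
      rw [h2] at h3
      exact h3.symm.trans h1
    have key := hcov.eqOn_of_comp_eqOn hconn (g₁ := s)
      (g₂ := fun w => s' (stereographic hv' ((stereographic hv).symm w)))
      s.continuous.continuousOn (fun w hw => ?_) (fun w hw => ?_)
      (a := stereographic hv (g p)) (hzero _ hvp hvp') ?_
    · intro y hy hy'
      have := key (hzero y hy hy')
      simpa [stereographic_symm_stereographic hv hy] using this
    · refine ContinuousAt.continuousWithinAt ?_
      exact s'.continuous.continuousAt.comp ((hcont _ hv' _ (hpole w hw)).comp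
        (isOpenEmbedding_stereographic_symm hv).continuous.continuousAt)
    · simp only [Function.comp_apply, hs, hs']
      rw [stereographic_symm_stereographic hv' (hpole w hw)]
    · simp only [hsp, stereographic_symm_stereographic hv hvp, hsp']
  -- The glued section.
  classical
  let τ : sphere (0 : V) 1 → S := fun y =>
    if (y : V) = v then s' (stereographic hv' y) else s (stereographic hv y)
  have hvv : v ≠ -v := ne_neg_of_norm_eq_one hv
  have hτ' : ∀ y : sphere (0 : V) 1, (y : V) ≠ -v → τ y = s' (stereographic hv' y) := by
    intro y hy
    by_cases h : (y : V) = v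
    · simp [τ, h]
    · simp only [τ, h, if_false]; exact hagree y h hy
  have hτ : ∀ y : sphere (0 : V) 1, (y : V) ≠ v → τ y = s (stereographic hv y) := fun y hy => by
    simp [τ, hy]
  have hgτ : ∀ y, g (τ y) = y := by
    intro y
    by_cases h : (y : V) = v
    · have h' : (y : V) ≠ -v := h ▸ hvv
      rw [hτ' y h', hs', stereographic_symm_stereographic hv' h']
    · rw [hτ y h, hs, stereographic_symm_stereographic hv h]
  have hτc : Continuous τ := by
    rw [continuous_iff_continuousAt]
    intro y
    have hne : ∀ u : V, (y : V) ≠ u → ∀ᶠ z : sphere (0 : V) 1 in 𝓝 y, (z : V) ≠ u := fun u hu =>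
      continuous_subtype_val.continuousAt.eventually (isOpen_ne.mem_nhds hu)
    by_cases h : (y : V) = v
    · have h' : (y : V) ≠ -v := h ▸ hvv
      exact (s'.continuous.continuousAt.comp (hcont _ hv' y h')).congr
        ((hne _ h').mono fun z hz => (hτ' z hz).symm)
    · exact (s.continuous.continuousAt.comp (hcont _ hv y h)).congr
        ((hne _ h).mono fun z hz => (hτ z hz).symm)
  have hid : τ ∘ g = id := hcov.eq_of_comp_eq (hτc.comp hcov.continuous) continuous_id
    (by ext1 q; simp [hgτ]) p (by
      simp only [Function.comp_apply, id]; rw [hτ _ hvp, hsp])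
  exact Function.LeftInverse.injective (g := τ) fun q => congrFun hid q

/-- A local homeomorphism from a nonempty compact space to a connected Hausdorff space is
surjective. -/
theorem IsLocalHomeomorph.surjective_of_compact {S X : Type*} [TopologicalSpace S]
    [TopologicalSpace X] [CompactSpace S] [Nonempty S] [T2Space X] [PreconnectedSpace X]
    {g : S → X} (hg : IsLocalHomeomorph g) : Function.Surjective g := by
  have h : IsClopen (range g) :=
    ⟨(isCompact_range hg.continuous).isClosed, hg.isOpenMap.isOpen_range⟩
  exact range_eq_univ.1 (h.eq_univ (range_nonempty g))

end SphereCovering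

/-! ### Horizontal surfaces and the dichotomy -/

namespace ProductSurface

section Slice

variable {U : Set Plane} {F : Plane → Ambient}

/-- In a horizontal surface of `ℍ² × ℝ` the first coordinate of `ℝ³` has no local maximum: its
differential cannot vanish. -/
theorem IsPatch.not_isLocalMax_of_horizontal (h : IsPatch (-1) U F) {x : Plane} (hx : x ∈ U)
    (hz : ∀ v, (fderiv ℝ F x v).2 = 0) : ¬ IsLocalMax (fun y => (F y).1 0) x := by
  intro hmax
  let l : Ambient →L[ℝ] ℝ :=
    (ContinuousLinearMap.proj (R := ℝ) (φ := fun _ : Fin 3 => ℝ) 0).comp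
      (ContinuousLinearMap.fst ℝ (Fin 3 → ℝ) ℝ)
  have h0 : ∀ v, (fderiv ℝ F x v).1 0 = 0 := by
    have h1 : fderiv ℝ (fun y => l (F y)) x = 0 := IsLocalMax.fderiv_eq_zero hmax
    rw [h.fderiv_clm l hx] at h1
    intro v
    simpa [l] using congrArg (fun L : Plane →L[ℝ] ℝ => L v) h1
  let m : Plane →ₗ[ℝ] ℝ := (LinearMap.proj 1).comp
    ((LinearMap.fst ℝ (Fin 3 → ℝ) ℝ).comp (fderiv ℝ F x : Plane →ₗ[ℝ] Ambient))
  obtain ⟨v, hv, hv0⟩ := (Submodule.ne_bot_iff _).1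
    (LinearMap.ker_ne_bot_of_finrank_lt (f := m) (by simp))
  have h1 : (fderiv ℝ F x v).1 1 = 0 := LinearMap.mem_ker.1 hv
  have h2 := h.form_fderiv_radial (Or.inr rfl) hx v
  have hb := (h.mem x hx).1.1
  have ht : (F x).1 2 ≠ 0 := by
    intro h3
    rw [h3] at hb
    nlinarith [sq_nonneg ((F x).1 0), sq_nonneg ((F x).1 1)]
  simp only [form, radial, h0, h1, hz] at h2
  have h3 : (fderiv ℝ F x v).1 2 = 0 := by
    have : (fderiv ℝ F x v).1 2 * (F x).1 2 = 0 := by linarith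
    exact (mul_eq_zero.1 this).resolve_right ht
  apply hv0
  refine h.immersion x hx (Eq.trans ?_ (map_zero _).symm)
  ext i
  · fin_cases i <;> simp [h0, h1, h3]
  · simp [hz]

/-- The cone over a horizontal surface of `𝕊² × ℝ` is a local diffeomorphism onto an open subset of
`ℝ³`. -/
theorem IsPatch.hasStrictFDerivAt_cone (h : IsPatch 1 U F) {x : Plane} (hx : x ∈ U)
    (hz : ∀ v, (fderiv ℝ F x v).2 = 0) :
    ∃ A : (Plane × ℝ) ≃L[ℝ] (Fin 3 → ℝ),
      HasStrictFDerivAt (fun y : Plane × ℝ => y.2 • (F y.1).1)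
        (A : (Plane × ℝ) →L[ℝ] (Fin 3 → ℝ)) (x, 1) := by
  have hF : HasStrictFDerivAt F (fderiv ℝ F x) x := (h.contDiffAt hx).hasStrictFDerivAt (by simp)
  have h1 : HasStrictFDerivAt (fun y : Plane × ℝ => F y.1)
      ((fderiv ℝ F x).comp (ContinuousLinearMap.fst ℝ Plane ℝ)) (x, 1) :=
    HasStrictFDerivAt.comp (g := F) (x, (1 : ℝ)) hF hasStrictFDerivAt_fst
  have h2 := (hasStrictFDerivAt_snd (𝕜 := ℝ) (p := (x, (1 : ℝ)))).smul h1.fst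
  set D := ((x, (1 : ℝ)).2 • ((ContinuousLinearMap.fst ℝ (Fin 3 → ℝ) ℝ).comp
    ((fderiv ℝ F x).comp (ContinuousLinearMap.fst ℝ Plane ℝ))) +
    (ContinuousLinearMap.snd ℝ Plane ℝ).smulRight (F x).1) with hD
  have hDapp : ∀ v s, D (v, s) = (fderiv ℝ F x v).1 + s • (F x).1 := by
    intro v s; simp [hD]
  have hinj : Function.Injective D := by
    rw [injective_iff_map_eq_zero]
    rintro ⟨v, s⟩ hvs
    rw [hDapp] at hvs
    have h3 : ∀ i, (fderiv ℝ F x v).1 i + s * (F x).1 i = 0 := fun i => congrFun hvs i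
    have h4 := h.form_fderiv_radial (Or.inl rfl) hx v
    have h5 := (h.mem x hx).1.1
    simp only [form, radial, hz] at h4
    have hs : s = 0 := by
      linear_combination (F x).1 0 * h3 0 + (F x).1 1 * h3 1 + (F x).1 2 * h3 2 - h4 - s * h5
    rw [hs, zero_smul, add_zero] at hvs
    have hv : v = 0 := h.immersion x hx ((Prod.ext hvs (hz v)).trans (map_zero _).symm)
    rw [hv, hs]; rfl
  let A := ContinuousLinearEquiv.ofBijective D (LinearMap.ker_eq_bot.2 hinj)
    (LinearMap.range_eq_top.2 ((LinearMap.injective_iff_surjective_of_finrank_eq_finrank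
      (f := (D : (Plane × ℝ) →ₗ[ℝ] (Fin 3 → ℝ))) (by simp)).1 hinj))
  exact ⟨A, h2⟩

theorem IsPatch.exists_injOn_fst (h : IsPatch 1 U F) {x : Plane} (hx : x ∈ U)
    (hz : ∀ v, (fderiv ℝ F x v).2 = 0) : ∃ W ∈ 𝓝 x, InjOn (fun y => (F y).1) W := by
  obtain ⟨A, hA⟩ := h.hasStrictFDerivAt_cone hx hz
  let e := hA.toOpenPartialHomeomorph
  have hs : e.source ∈ 𝓝 (x, (1 : ℝ)) :=
    e.open_source.mem_nhds hA.mem_toOpenPartialHomeomorph_source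
  have hc : Continuous fun y : Plane => (y, (1 : ℝ)) := by fun_prop
  refine ⟨_, hc.continuousAt.preimage_mem_nhds hs, fun y hy y' hy' hyy => ?_⟩
  have := e.injOn hy hy' (show (1 : ℝ) • (F y).1 = (1 : ℝ) • (F y').1 by
    rw [show (F y).1 = (F y').1 from hyy])
  exact congrArg Prod.fst this

/-- A horizontal surface of `𝕊² × ℝ` is open in its slice. -/
theorem IsPatch.exists_nhds_fst (h : IsPatch 1 U F) {x : Plane} (hx : x ∈ U)
    (hz : ∀ v, (fderiv ℝ F x v).2 = 0) {W : Set Plane} (hW : W ∈ 𝓝 x) :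
    ∃ O ∈ 𝓝 (F x).1, ∀ y ∈ O, y ∈ base 1 → ∃ w ∈ W, (F w).1 = y := by
  obtain ⟨A, hA⟩ := h.hasStrictFDerivAt_cone hx hz
  have hmap := hA.map_nhds_eq_of_equiv
  simp only [one_smul] at hmap
  have h1 : (W ∩ U) ×ˢ Ioi (0 : ℝ) ∈ 𝓝 (x, (1 : ℝ)) :=
    prod_mem_nhds (inter_mem hW (h.isOpen.mem_nhds hx)) (Ioi_mem_nhds one_pos)
  refine ⟨_, hmap ▸ image_mem_map h1, ?_⟩
  rintro y ⟨⟨w, r⟩, ⟨⟨hwW, hwU⟩, hr⟩, rfl⟩ hy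
  refine ⟨w, hwW, ?_⟩
  have h2 := hy.1
  have h3 := (h.mem w hwU).1.1
  have hr0 : 0 < r := hr
  simp only [Pi.smul_apply, smul_eq_mul] at h2
  -- Both `F w` and its positive multiple `r F w` are unit vectors.
  have h4 : r ^ 2 = 1 := by linear_combination h2 - r ^ 2 * h3
  have h5 : r = 1 := by nlinarith
  simp [h5]

end Slice

variable {S : Type*} [TopologicalSpace S] [ChartedSpace (EuclideanSpace ℝ (Fin 2)) S]
  [IsManifold (𝓡 2) 2 S]

theorem IsPatch.fderiv_snd_eq_zero {κ : ℝ} {U : Set Plane} {F : Plane → Ambient}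
    (h : IsPatch κ U F) {x : Plane} (hx : x ∈ U) (hF : ∀ y, (F y).2 = (F x).2) (v : Plane) :
    (fderiv ℝ F x v).2 = 0 :=
  h.crit_of_isLocalMax one_ne_zero hx (Filter.Eventually.of_forall fun y => by simp [hF y]) v

/-- There is no closed horizontal surface in `ℍ² × ℝ`. -/
theorem IsImmersedSurface.false_of_height_eq [CompactSpace S] [Nonempty S] {f : S → Ambient}
    (h : IsImmersedSurface (-1) f) {p₀ : S} (hf : ∀ q, (f q).2 = (f p₀).2) : False := by
  have hc : Continuous fun p => (f p).1 0 :=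
    (continuous_apply 0).comp h.contMDiff.continuous.fst
  obtain ⟨p, -, hp⟩ := isCompact_univ.exists_isMaxOn univ_nonempty hc.continuousOn
  have hx := mem_extChartAt_target (I := 𝓡 2) p
  have hP := h.isPatch p
  refine hP.not_isLocalMax_of_horizontal hx
    (hP.fderiv_snd_eq_zero hx fun y => (hf _).trans (hf _).symm)
    (Filter.Eventually.of_forall fun y => ?_)
  have := hp (mem_univ ((extChartAt (𝓡 2) p).symm y))
  simpa using this

/-- The projection of a surface of `𝕊² × ℝ` to the unit sphere of Euclidean space. -/
noncomputable def toSphere {f : S → Ambient} (h : IsImmersedSurface 1 f) (p : S) :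
    sphere (0 : EuclideanSpace ℝ (Fin 3)) 1 :=
  ⟨WithLp.toLp 2 (f p).1, by
    have := (h.mem p).1.1
    rw [mem_sphere_zero_iff_norm, EuclideanSpace.norm_eq, Fin.sum_univ_three]
    simp only [Real.norm_eq_abs, sq_abs]
    rw [Real.sqrt_eq_one]
    linarith⟩

theorem isLocalHomeomorph_toSphere {f : S → Ambient} (h : IsImmersedSurface 1 f) {p₀ : S}
    (hf : ∀ q, (f q).2 = (f p₀).2) : IsLocalHomeomorph (toSphere h) := by
  have hcont : Continuous (toSphere h) := by
    refine Continuous.subtype_mk ?_ _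
    exact (PiLp.continuous_toLp 2 _).comp h.contMDiff.continuous.fst
  have hz : ∀ p, ∀ v, (fderiv ℝ (f ∘ (extChartAt (𝓡 2) p).symm) (extChartAt (𝓡 2) p p) v).2 = 0 :=
    fun p => (h.isPatch p).fderiv_snd_eq_zero (mem_extChartAt_target (I := 𝓡 2) p)
      fun y => (hf _).trans (hf _).symm
  have hopen : IsOpenMap (toSphere h) := by
    rw [isOpenMap_iff_nhds_le]
    intro p s hs
    have hW : (extChartAt (𝓡 2) p).symm ⁻¹' (toSphere h ⁻¹' s) ∈ 𝓝 (extChartAt (𝓡 2) p p) :=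
      (continuousAt_extChartAt_symm p).preimage_mem_nhds (by simpa using hs)
    obtain ⟨O, hO, hOs⟩ := (h.isPatch p).exists_nhds_fst (mem_extChartAt_target (I := 𝓡 2) p)
      (hz p) hW
    have hc : Continuous fun y : sphere (0 : EuclideanSpace ℝ (Fin 3)) 1 =>
        (y : EuclideanSpace ℝ (Fin 3)).ofLp :=
      (PiLp.continuous_ofLp 2 _).comp continuous_subtype_val
    have hO' : O ∈ 𝓝 ((toSphere h p : EuclideanSpace ℝ (Fin 3)).ofLp) := by
      simpa [toSphere] using hO
    filter_upwards [hc.continuousAt.preimage_mem_nhds hO'] with y hy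
    obtain ⟨w, hw, hwy⟩ := hOs _ hy (by
      have h1 := y.2
      rw [mem_sphere_zero_iff_norm, EuclideanSpace.norm_eq, Fin.sum_univ_three,
        Real.sqrt_eq_one] at h1
      simp only [Real.norm_eq_abs, sq_abs] at h1
      exact ⟨by rw [one_mul, h1]; norm_num, by norm_num⟩)
    have h2 : toSphere h ((extChartAt (𝓡 2) p).symm w) = y := by
      refine Subtype.ext ?_
      change WithLp.toLp 2 _ = _
      rw [show (f ((extChartAt (𝓡 2) p).symm w)).1 = _ from hwy]
    exact h2 ▸ hw
  rw [isLocalHomeomorph_iff_isOpenEmbedding_restrict]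
  intro p
  obtain ⟨W, hW, hinj⟩ := (h.isPatch p).exists_injOn_fst (mem_extChartAt_target (I := 𝓡 2) p) (hz p)
  have hN : (extChartAt (𝓡 2) p) ⁻¹' W ∩ (extChartAt (𝓡 2) p).source ∈ 𝓝 p :=
    inter_mem ((continuousAt_extChartAt p).preimage_mem_nhds hW) (extChartAt_source_mem_nhds p)
  obtain ⟨V, hVN, hVo, hpV⟩ := mem_nhds_iff.1 hN
  refine ⟨V, hVo.mem_nhds hpV, ?_⟩
  refine .of_continuous_injective_isOpenMap (hcont.comp continuous_subtype_val) ?_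
    (hopen.comp hVo.isOpenMap_subtype_val)
  rintro ⟨q, hq⟩ ⟨q', hq'⟩ hqq
  have h1 : (f q).1 = (f q').1 := by
    have := congrArg (fun y : sphere (0 : EuclideanSpace ℝ (Fin 3)) 1 =>
      (y : EuclideanSpace ℝ (Fin 3)).ofLp) hqq
    simpa [toSphere] using this
  refine Subtype.ext ((extChartAt (𝓡 2) p).injOn (hVN hq).2 (hVN hq').2
    (hinj (hVN hq).1 (hVN hq').1 ?_))
  simp only [Function.comp_apply]
  rw [(extChartAt (𝓡 2) p).left_inv (hVN hq).2, (extChartAt (𝓡 2) p).left_inv (hVN hq').2, h1]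

/-- A closed horizontal surface of `𝕊² × ℝ` is an embedded slice. -/
theorem IsImmersedSurface.injective_and_range_eq [T2Space S] [CompactSpace S] [ConnectedSpace S]
    {f : S → Ambient} (h : IsImmersedSurface 1 f) {p₀ : S} (hf : ∀ q, (f q).2 = (f p₀).2) :
    Function.Injective f ∧ range f = base 1 ×ˢ {(f p₀).2} := by
  have hl := isLocalHomeomorph_toSphere h hf
  have hrank : 1 < Module.rank ℝ (EuclideanSpace ℝ (Fin 3)) := by
    rw [← Module.finrank_eq_rank]; simp
  have : PreconnectedSpace (sphere (0 : EuclideanSpace ℝ (Fin 3)) 1) :=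
    Subtype.preconnectedSpace (isPreconnected_sphere hrank 0 1)
  refine ⟨fun q q' hqq => ?_, Subset.antisymm ?_ ?_⟩
  · refine hl.injective_of_sphere (by simp) (Subtype.ext ?_)
    simp [toSphere, hqq]
  · rintro _ ⟨q, rfl⟩
    exact ⟨(h.mem q).1, hf q⟩
  · rintro ⟨y, t⟩ ⟨hy, ht⟩
    obtain ⟨q, hq⟩ := hl.surjective_of_compact ⟨WithLp.toLp 2 y, by
      have := hy.1
      simp only at this
      rw [mem_sphere_zero_iff_norm, EuclideanSpace.norm_eq, Fin.sum_univ_three]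
      simp only [Real.norm_eq_abs, sq_abs]
      rw [Real.sqrt_eq_one]
      linarith⟩
    refine ⟨q, Prod.ext ?_ ((hf q).trans ht.symm)⟩
    simpa [toSphere] using congrArg Subtype.val hq

/-- The dichotomy behind both cases: a closed `H`-surface that is not horizontal forces `H (-1)` and
`H 1` to have the same sign, and a horizontal one forces `H` to vanish at one of `±1`. -/
theorem IsHSurface.pos_or_horizontal [CompactSpace S] [ConnectedSpace S] {κ : ℝ}
    (hκ : κ = 1 ∨ κ = -1) {H : ℝ → ℝ} (hH : ContDiffOn ℝ 1 H (Icc (-1) 1)) {f η : S → Ambient}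
    (h : IsHSurface κ H f η) :
    0 < H (-1) * H 1 ∨ (H (-1) * H 1 = 0 ∧ ∃ p₀, ∀ q, (f q).2 = (f p₀).2) := by
  have hc : Continuous fun p => (f p).2 := h.immersed.contMDiff.continuous.snd
  obtain ⟨p, -, hp⟩ := isCompact_univ.exists_isMaxOn univ_nonempty hc.continuousOn
  obtain ⟨q, -, hq⟩ := isCompact_univ.exists_isMinOn univ_nonempty hc.continuousOn
  have hpmax : ∀ r, (1 : ℝ) * (f r).2 ≤ 1 * (f p).2 := fun r => by simpa using hp (mem_univ r)
  have hqmax : ∀ r, (-1 : ℝ) * (f r).2 ≤ -1 * (f q).2 := fun r => by simpa using hq (mem_univ r)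
  have hp1 := sq_eq_one_iff.1 (h.normal_snd_sq hκ one_ne_zero hpmax)
  have hq1 := sq_eq_one_iff.1 (h.normal_snd_sq hκ (by norm_num) hqmax)
  have hzero : ∀ r, ((η r).2 = 1 ∨ (η r).2 = -1) → H (η r).2 = 0 → H (-1) * H 1 = 0 := by
    rintro r (hr | hr) h0 <;> rw [hr] at h0 <;> simp [h0]
  by_cases hHp : H (η p).2 = 0
  · exact Or.inr ⟨hzero p hp1 hHp, p, h.height_eq hκ hH (by norm_num) hpmax hHp⟩
  by_cases hHq : H (η q).2 = 0
  · exact Or.inr ⟨hzero q hq1 hHq, q, h.height_eq hκ hH (by norm_num) hqmax hHq⟩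
  left
  have h1 := h.mul_nonpos_of_isMax hκ one_ne_zero hpmax
  have h2 := h.mul_nonpos_of_isMax hκ (by norm_num) hqmax
  rcases hp1 with hp1 | hp1 <;> rcases hq1 with hq1 | hq1 <;> rw [hp1] at h1 hHp <;>
    rw [hq1] at h2 hHq
  · exact absurd (by linarith : H 1 = 0) hHp
  · have h3 : H 1 < 0 := lt_of_le_of_ne (by linarith) hHp
    have h4 : H (-1) < 0 := lt_of_le_of_ne (by linarith) hHq
    exact mul_pos_of_neg_of_neg h4 h3
  · have h3 : 0 < H 1 := lt_of_le_of_ne (by linarith) (Ne.symm hHq)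
    have h4 : 0 < H (-1) := lt_of_le_of_ne (by linarith) (Ne.symm hHp)
    exact mul_pos h4 h3
  · exact absurd (by linarith : H (-1) = 0) hHp

end ProductSurface

theorem proposition3p5 (H : ℝ → ℝ) (hH : ContDiffOn ℝ 1 H (Set.Icc (-1) 1))
    {S : Type*} [TopologicalSpace S] [T2Space S] [CompactSpace S] [ConnectedSpace S]
    [ChartedSpace (EuclideanSpace ℝ (Fin 2)) S] [IsManifold (𝓡 2) 2 S]
    (f η : S → ProductSurface.Ambient) :
    (ProductSurface.IsHSurface (-1) H f η → 0 < H (-1) * H 1) ∧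
    (ProductSurface.IsHSurface 1 H f η →
      0 < H (-1) * H 1 ∨
      (H (-1) * H 1 = 0 ∧ Function.Injective f ∧
        ∃ t₀ : ℝ, Set.range f = ProductSurface.base 1 ×ˢ {t₀})) := by
  refine ⟨fun h => ?_, fun h => ?_⟩
  · rcases h.pos_or_horizontal (Or.inr rfl) hH with hpos | ⟨-, p₀, hf⟩
    · exact hpos
    · exact (h.immersed.false_of_height_eq hf).elim
  · rcases h.pos_or_horizontal (Or.inl rfl) hH with hpos | ⟨h0, p₀, hf⟩
    · exact Or.inl hpos
    · obtain ⟨hinj, hrange⟩ := h.immersed.injective_and_range_eq hf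
      exact Or.inr ⟨h0, hinj, _, hrange⟩
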